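/- Let $0<\alpha<1$ and let $L=(L(t))_{t\ge 0}$ be an $\alpha$-selfsimilar subordinator, that is, a Lévy process with $L(0)=0$ and càdlàg paths almost surely, with non-negative increments, and with Laplace transform $$\mathbf E\big[e^{-\omega L(t)}\big]=\exp\Big\{-t\int_0^\infty (1-e^{-\omega x})\,\lambda(dx)\Big\},\qquad \omega\ge 0,\ t\ge 0,$$ where $\lambda(dx)=\alpha x^{-1-\alpha}\,dx$ on $(0,\infty)$ (so that $\lambda((x,\infty))=x^{-\alpha}$ for $x>0$). For $t>0$ let $X_1(t)$ be the size of the largest flight (jump) of $L$ during $[0,t]$; almost surely a largest flight exists and $X_1(t)>0$. Set $$\xi(t)=\frac{L(t)-X_1(t)}{X_1(t)},\qquad t>0,\qquad\text{and}\qquad G_\alpha(\omega)=\alpha\int_0^1\frac{1-e^{-\omega u}}{u^{1+\alpha}}\,du,\qquad \omega\ge 0.$$ Then the law of $\xi(t)$ does not depend on $t>0$, and for every $t>0$ its Laplace transform is $$\mathbf E\big[e^{-\omega\xi(t)}\big]=\frac{1}{1+G_\alpha(\omega)},\qquad \omega\ge 0.$$ Moreover, for every $t>0$, $\xi(t)$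 is square-integrable, with $$\mathbf E[\xi(t)]=\frac{\alpha}{1-\alpha},\qquad \mathbf{Var}(\xi(t))=\frac{\alpha}{(1-\alpha)^2(2-\alpha)},\qquad \mathbf{Var}\!\left(\frac{\xi(t)}{\mathbf E[\xi(t)]}\right)=\frac{1}{\alpha(2-\alpha)}.$$ -/

import Mathlib

open MeasureTheory ProbabilityTheory Filter Topology Set
open scoped NNReal ENNReal

noncomputable section

/-- `L = (L(t))_{t ≥ 0}` is a (real-valued) Lévy process under `P`: it starts at zero, has
independent and stationary increments, is continuous in probability, and almost all its paths are
right-continuous with left limits. -/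
structure IsLevyProcess {Ω : Type*} [MeasurableSpace Ω] (L : ℝ≥0 → Ω → ℝ) (P : Measure Ω) :
    Prop where
  measurable : ∀ t, Measurable (L t)
  zero : ∀ᵐ ω ∂P, L 0 ω = 0
  indep_increments : HasIndepIncrements L P
  stationary_increments :
    ∀ s t h : ℝ≥0, IdentDistrib (L (s + h) - L s) (L (t + h) - L t) P P
  continuous_in_probability : ∀ t : ℝ≥0, TendstoInMeasure P L (𝓝 t) (L t)
  cadlag : ∀ᵐ ω ∂P, ∀ t : ℝ≥0,
    ContinuousWithinAt (fun s => L s ω) (Ioi t) t ∧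
      ∃ l : ℝ, Tendsto (fun s => L s ω) (𝓝[<] t) (𝓝 l)

/-- A one-sided Lévy process (subordinator): a Lévy process with non-negative increments. -/
structure IsOneSidedLevyProcess {Ω : Type*} [MeasurableSpace Ω] (L : ℝ≥0 → Ω → ℝ)
    (P : Measure Ω) : Prop extends IsLevyProcess L P where
  increments_nonneg : ∀ s t : ℝ≥0, s ≤ t → ∀ᵐ ω ∂P, 0 ≤ L t ω - L s ω

/-- A measure `lam` concentrated on `(0, ∞)` with `∫ min(x, 1) lam(dx) < ∞`. -/
structure IsOneSidedLevyMeasure (lam : Measure ℝ) : Prop where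
  concentrated : lam (Iic 0) = 0
  integrability : ∫⁻ x in Ioi 0, ENNReal.ofReal (min x 1) ∂lam < ∞

/-- The Lévy characteristic `Ψ(ω) = ∫_{(0,∞)} (1 - exp(-ω x)) lam(dx)`. -/
def levyCharacteristic (lam : Measure ℝ) (w : ℝ) : ℝ :=
  ∫ x in Ioi (0 : ℝ), (1 - Real.exp (-w * x)) ∂lam

/-- `lam` is the Lévy measure of the (driftless) one-sided process `L`:
`E[exp(-ω L(t))] = exp(-Ψ(ω) t)` for all `ω ≥ 0`, `t ≥ 0`. -/
structure HasLevyMeasure {Ω : Type*} [MeasurableSpace Ω] (L : ℝ≥0 → Ω → ℝ) (P : Measure Ω)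
    (lam : Measure ℝ) : Prop where
  levy_measure : IsOneSidedLevyMeasure lam
  laplace : ∀ t : ℝ≥0, ∀ w : ℝ, 0 ≤ w →
    ∫ ω, Real.exp (-w * L t ω) ∂P = Real.exp (-levyCharacteristic lam w * t)

/-- The measure `α x^{-(1+α)} dx` on `(0, ∞)`, whose tail is `x^{-α}`. -/
def selfsimilarLevyMeasure (α : ℝ) : Measure ℝ :=
  (volume.restrict (Ioi 0)).withDensity fun x => ENNReal.ofReal (α / x ^ (1 + α))

/-- `L` is an `α`-selfsimilar one-sided Lévy process. -/
structure IsSelfsimilarSubordinator {Ω : Type*} [MeasurableSpace Ω] (α : ℝ)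
    (L : ℝ≥0 → Ω → ℝ) (P : Measure Ω) : Prop extends IsOneSidedLevyProcess L P where
  hasLevyMeasure : HasLevyMeasure L P (selfsimilarLevyMeasure α)

/-- The set of sizes of the flights (positive jumps) of `L` during the time interval `[0, t]`. -/
def flightSizes {Ω : Type*} (L : ℝ≥0 → Ω → ℝ) (t : ℝ≥0) (ω : Ω) : Set ℝ :=
  {x | 0 < x ∧ ∃ s ≤ t, x = L s ω - Function.leftLim (fun r => L r ω) s}

/-- The greatest flight `X₁(t)` during `[0, t]`. -/
def greatestFlight {Ω : Type*} (L : ℝ≥0 → Ω → ℝ) (t : ℝ≥0) (ω : Ω) : ℝ :=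
  sSup (flightSizes L t ω)

/-- The ratio `ξ(t) = (L(t) - X₁(t)) / X₁(t)`. -/
def restRatio {Ω : Type*} (L : ℝ≥0 → Ω → ℝ) (t : ℝ≥0) (ω : Ω) : ℝ :=
  (L t ω - greatestFlight L t ω) / greatestFlight L t ω

/-- `G_α(ω) = α ∫₀¹ (1 - exp(-ω u)) u^{-(1+α)} du`. -/
def GFun (α w : ℝ) : ℝ :=
  α * ∫ u in (0 : ℝ)..1, (1 - Real.exp (-w * u)) / u ^ (1 + α)

end

/-! Write X for the greatest flight up to time t and G for `GFun α`. Everything rests on the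
truncated transform E[exp(-w L(t)); X ≤ x] = exp(-t ∫ (1 - 1_{y<x} exp(-w y)) λ(dy)), valid for any
one-sided Lévy measure without atom at x (`integral_exp_greatestFlight_le`). It is obtained without
a Poisson point process: X is the limit of the greatest increment over uniform partitions, the
increments are i.i.d., and a product of a function of them has expectation (E F(L(t/n)))^n. The
limit of this power is found in the variable u = exp(-y): the Laplace transform at integers gives
the moments of u, and Weierstrass approximation extends the limit to other functions.

For the selfsimilar measure the exponent is -t x^{-α} (1 + G(w x)). The ratio is reached by writing
1 - exp(-w L/X) as the integral of w L exp(-r w L) over 0 < r ≤ 1/X and exchanging integrals: the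
inner expectation is a derivative of the truncated transform at level x = 1/r and frequency w r,
whose product is w whatever r is. The remaining integral in r is explicit, does not involve t, and
gives E[1 - exp(-w L/X)] = w G'(w) / (α (1 + G(w))) (`integral_one_sub_exp_div`). Integration by
parts, w G'(w) = α (G(w) + 1 - exp(-w)) (`mul_GFunDeriv`), and L/X = ξ + 1 yield 1/(1 + G(w)).

The law of ξ is determined by this transform, hence is free of t; its first two moments come from
the behaviour of G at 0. -/

/-! ### Jumps of a monotone path as limits of increments over uniform partitions. -/

/-- The `i`-th point of the uniform partition of `[0, t]` into `n + 1` intervals. -/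
noncomputable def gridPoint (t : ℝ≥0) (n i : ℕ) : ℝ≥0 := i * (t / (n + 1))

/-- The greatest increment of `f` along the uniform partition of `[0, t]` into `n + 1` intervals. -/
noncomputable def gridMax (f : ℝ≥0 → ℝ) (t : ℝ≥0) (n : ℕ) : ℝ :=
  (Finset.range (n + 1)).sup' Finset.nonempty_range_add_one
    fun i => f (gridPoint t n (i + 1)) - f (gridPoint t n i)

lemma gridPoint_succ (t : ℝ≥0) (n i : ℕ) :
    gridPoint t n (i + 1) = gridPoint t n i + t / (n + 1) := by
  simp [gridPoint, add_mul]

lemma gridPoint_mono (t : ℝ≥0) (n : ℕ) : Monotone (gridPoint t n) :=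
  monotone_nat_of_le_succ fun i => by simp [gridPoint_succ]

lemma gridPoint_zero (t : ℝ≥0) (n : ℕ) : gridPoint t n 0 = 0 := by simp [gridPoint]

lemma gridPoint_last (t : ℝ≥0) (n : ℕ) : gridPoint t n (n + 1) = t := by
  have : (n : ℝ≥0) + 1 ≠ 0 := by positivity
  simp only [gridPoint, Nat.cast_add, Nat.cast_one]
  field_simp

lemma exists_gridPoint_lt_le {t s : ℝ≥0} (n : ℕ) (hs0 : 0 < s) (hst : s ≤ t) :
    ∃ i < n + 1, gridPoint t n i < s ∧ s ≤ gridPoint t n (i + 1) := by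
  classical
  have hex : ∃ j, s ≤ gridPoint t n j := ⟨n + 1, by rwa [gridPoint_last]⟩
  have h0 : Nat.find hex ≠ 0 := fun h => by
    have := Nat.find_spec hex
    rw [h, gridPoint_zero] at this
    exact absurd hs0 (not_lt.2 this)
  obtain ⟨i, hi⟩ := Nat.exists_eq_succ_of_ne_zero h0
  have hle : Nat.find hex ≤ n + 1 := Nat.find_min' hex (by rwa [gridPoint_last])
  refine ⟨i, by omega, ?_, ?_⟩
  · exact not_le.1 (Nat.find_min hex (by omega))
  · have := Nat.find_spec hex
    rwa [hi] at this

lemma le_gridMax {f : ℝ≥0 → ℝ} {t : ℝ≥0} {n i : ℕ} (hi : i < n + 1) :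
    f (gridPoint t n (i + 1)) - f (gridPoint t n i) ≤ gridMax f t n :=
  Finset.le_sup' (fun i => f (gridPoint t n (i + 1)) - f (gridPoint t n i))
    (Finset.mem_range.2 hi)

lemma gridMax_lt_iff {f : ℝ≥0 → ℝ} {t : ℝ≥0} {n : ℕ} {y : ℝ} :
    gridMax f t n < y ↔
      ∀ i < n + 1, f (gridPoint t n (i + 1)) - f (gridPoint t n i) < y := by
  simp [gridMax, Finset.sup'_lt_iff]

lemma gridMax_le_iff {f : ℝ≥0 → ℝ} {t : ℝ≥0} {n : ℕ} {y : ℝ} :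
    gridMax f t n ≤ y ↔
      ∀ i < n + 1, f (gridPoint t n (i + 1)) - f (gridPoint t n i) ≤ y := by
  simp [gridMax, Finset.sup'_le_iff]

lemma gridMax_nonneg {f : ℝ≥0 → ℝ} (hf : Monotone f) (t : ℝ≥0) (n : ℕ) : 0 ≤ gridMax f t n :=
  (sub_nonneg.2 (hf (gridPoint_mono t n (Nat.le_succ 0)))).trans (le_gridMax (Nat.succ_pos n))

lemma jump_le_gridMax {f : ℝ≥0 → ℝ} (hf : Monotone f) {t s : ℝ≥0} (hst : s ≤ t) (n : ℕ) :
    f s - Function.leftLim f s ≤ gridMax f t n := by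
  rcases eq_or_lt_of_le (zero_le : 0 ≤ s) with rfl | hs
  -- At time 0 the convention for `leftLim` returns the value itself, so no jump is counted there.
  · rw [leftLim_eq_of_isBot (fun x => zero_le), sub_self]
    exact gridMax_nonneg hf t n
  · obtain ⟨i, hi, h1, h2⟩ := exists_gridPoint_lt_le n hs hst
    exact (sub_le_sub (hf h2) (hf.le_leftLim h1)).trans (le_gridMax hi)

/-- If all jumps of a right-continuous monotone path on `[0, t]` are less than `y`, then so are its
increments along fine uniform partitions. -/
lemma eventually_gridMax_lt {f : ℝ≥0 → ℝ} (hf : Monotone f)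
    (hr : ∀ s, ContinuousWithinAt f (Ioi s) s) {t : ℝ≥0} {y : ℝ}
    (hy : ∀ s ≤ t, f s - Function.leftLim f s < y) : ∀ᶠ n in atTop, gridMax f t n < y := by
  -- Near s the path stays between its left limit minus e and its value plus e; with e half the gap
  -- between y and the jump, increments inside this neighbourhood are below y. A Lebesgue number
  -- makes the scale uniform on `[0, t]`.
  have hU : ∀ s ∈ Icc 0 t, ∃ U : Set ℝ≥0, IsOpen U ∧ s ∈ U ∧
      ∀ a ∈ U, ∀ b ∈ U, f b - f a < y := by
    intro s hs
    set e := (y - (f s - Function.leftLim f s)) / 2 with he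
    have he0 : 0 < e := half_pos (sub_pos.2 (hy s hs.2))
    have h1 : ∀ᶠ r in 𝓝[<] s, Function.leftLim f s - e < f r ∧ f r < f s + e := by
      filter_upwards [(hf.tendsto_leftLim s).eventually (lt_mem_nhds (sub_lt_self _ he0)),
        self_mem_nhdsWithin] with r hr1 hr2
      exact ⟨hr1, (hf (le_of_lt hr2)).trans_lt (lt_add_of_pos_right _ he0)⟩
    have hl : Function.leftLim f s ≤ f s := hf.leftLim_le le_rfl
    have h2 : ∀ᶠ r in 𝓝[>] s, Function.leftLim f s - e < f r ∧ f r < f s + e := by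
      filter_upwards [(hr s).eventually (gt_mem_nhds (lt_add_of_pos_right _ he0)),
        self_mem_nhdsWithin] with r hr1 hr2
      exact ⟨by linarith [hf (le_of_lt hr2)], hr1⟩
    have h3 : ∀ᶠ r in 𝓝 s, Function.leftLim f s - e < f r ∧ f r < f s + e := by
      rw [← nhdsLT_sup_nhdsGE, eventually_sup, ← Ioi_insert, nhdsWithin_insert, eventually_sup]
      exact ⟨h1, by simpa using ⟨by linarith, he0⟩, h2⟩
    obtain ⟨U, hU1, hU2, hU3⟩ := eventually_nhds_iff.1 h3
    refine ⟨U, hU2, hU3, fun a ha b hb => ?_⟩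
    linarith [(hU1 a ha).1, (hU1 b hb).2]
  choose! U hUo hUs hUy using hU
  obtain ⟨δ, hδ, hball⟩ := lebesgue_number_lemma_of_metric (s := Icc (0 : ℝ≥0) t)
    (c := fun s : Icc (0 : ℝ≥0) t => U s) isCompact_Icc (fun s => hUo s s.2)
    (fun s hs => mem_iUnion.2 ⟨⟨s, hs⟩, hUs s hs⟩)
  have hlim : Tendsto (fun n : ℕ => (t : ℝ) / ((n : ℝ) + 1)) atTop (𝓝 0) := by
    simpa [div_eq_mul_inv] using
      (tendsto_one_div_add_atTop_nhds_zero_nat (𝕜 := ℝ)).const_mul (t : ℝ)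
  filter_upwards [hlim.eventually (gt_mem_nhds hδ)] with n hn
  rw [gridMax_lt_iff]
  intro i hi
  have hmem : gridPoint t n i ∈ Icc 0 t := ⟨zero_le, by
    simpa [gridPoint_last] using gridPoint_mono t n hi.le⟩
  obtain ⟨s, hs⟩ := hball _ hmem
  refine hUy s s.2 _ (hs (Metric.mem_ball_self hδ)) _ (hs ?_)
  rw [gridPoint_succ, Metric.mem_ball, NNReal.dist_eq]
  have habs : |(t : ℝ) / ((n : ℝ) + 1)| < δ := by rwa [abs_of_nonneg (by positivity)]
  simpa using habs

section greatestFlight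

variable {Ω : Type*} {L : ℝ≥0 → Ω → ℝ} {t : ℝ≥0} {ω : Ω}

lemma greatestFlight_nonneg : 0 ≤ greatestFlight L t ω :=
  Real.sSup_nonneg fun _ hx => hx.1.le

lemma greatestFlight_le_gridMax (hf : Monotone fun s => L s ω) (n : ℕ) :
    greatestFlight L t ω ≤ gridMax (fun s => L s ω) t n := by
  refine Real.sSup_le ?_ (gridMax_nonneg hf t n)
  rintro x ⟨-, s, hs, rfl⟩
  exact jump_le_gridMax hf hs n

lemma bddAbove_flightSizes (hf : Monotone fun s => L s ω) : BddAbove (flightSizes L t ω) := by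
  refine ⟨gridMax (fun s => L s ω) t 0, ?_⟩
  rintro x ⟨-, s, hs, rfl⟩
  exact jump_le_gridMax hf hs 0

lemma greatestFlight_le_sub (hf : Monotone fun s => L s ω) :
    greatestFlight L t ω ≤ L t ω - L 0 ω := by
  have h : gridMax (fun s => L s ω) t 0 = L t ω - L 0 ω := by
    simp [gridMax, gridPoint]
  exact h ▸ greatestFlight_le_gridMax hf 0

lemma jump_le_greatestFlight (hf : Monotone fun s => L s ω) {s : ℝ≥0} (hs : s ≤ t) :
    L s ω - Function.leftLim (fun r => L r ω) s ≤ greatestFlight L t ω := by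
  by_cases h : 0 < L s ω - Function.leftLim (fun r => L r ω) s
  · exact le_csSup (bddAbove_flightSizes hf) ⟨h, s, hs, rfl⟩
  · exact (not_lt.1 h).trans greatestFlight_nonneg

lemma eventually_gridMax_lt_of_greatestFlight_lt (hf : Monotone fun s => L s ω)
    (hr : ∀ s, ContinuousWithinAt (fun s => L s ω) (Ioi s) s) {y : ℝ}
    (hy : greatestFlight L t ω < y) : ∀ᶠ n in atTop, gridMax (fun s => L s ω) t n < y :=
  eventually_gridMax_lt hf hr fun _ hs => (jump_le_greatestFlight hf hs).trans_lt hy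

lemma tendsto_gridMax (hf : Monotone fun s => L s ω)
    (hr : ∀ s, ContinuousWithinAt (fun s => L s ω) (Ioi s) s) :
    Tendsto (gridMax (fun s => L s ω) t) atTop (𝓝 (greatestFlight L t ω)) :=
  tendsto_order.2 ⟨fun _ hy => Eventually.of_forall fun n =>
    hy.trans_le (greatestFlight_le_gridMax hf n),
    fun _ hy => eventually_gridMax_lt_of_greatestFlight_lt hf hr hy⟩

/-- Were the supremum not attained, all jumps would be strictly below it, and so would `gridMax` for
fine partitions, whereas `gridMax` always dominates the supremum. -/
lemma isGreatest_greatestFlight (hf : Monotone fun s => L s ω)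
    (hr : ∀ s, ContinuousWithinAt (fun s => L s ω) (Ioi s) s) (h0 : 0 < greatestFlight L t ω) :
    IsGreatest (flightSizes L t ω) (greatestFlight L t ω) := by
  refine ⟨?_, fun x hx => le_csSup (bddAbove_flightSizes hf) hx⟩
  by_contra hcon
  have hlt : ∀ s ≤ t, L s ω - Function.leftLim (fun r => L r ω) s < greatestFlight L t ω := by
    intro s hs
    refine lt_of_le_of_ne (jump_le_greatestFlight hf hs) fun heq => hcon ⟨h0, s, hs, heq.symm⟩
  obtain ⟨n, hn⟩ := (eventually_gridMax_lt hf hr hlt).exists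
  exact absurd hn (not_lt.2 (greatestFlight_le_gridMax hf n))

end greatestFlight

/-! ### Monotonicity of almost every path and measurability of the greatest flight. -/

section process

variable {Ω : Type*} [MeasurableSpace Ω] {L : ℝ≥0 → Ω → ℝ} {P : Measure Ω}

lemma measurable_gridMax (hL : ∀ s, Measurable (L s)) (t : ℝ≥0) (n : ℕ) :
    Measurable fun ω => gridMax (fun s => L s ω) t n := by
  have := Finset.measurable_sup' (s := Finset.range (n + 1)) Finset.nonempty_range_add_one
    (f := fun i ω => L (gridPoint t n (i + 1)) ω - L (gridPoint t n i) ω)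
    (fun i _ => (hL _).sub (hL _))
  convert this using 2 with ω
  simp [gridMax]

/-- The null sets in `increments_nonneg` depend on the pair of times; only rational pairs are used,
and right-continuity carries the inequality to all times. -/
lemma IsOneSidedLevyProcess.ae_monotone (hL : IsOneSidedLevyProcess L P) :
    ∀ᵐ ω ∂P, Monotone fun s => L s ω := by
  have h1 : ∀ᵐ ω ∂P, ∀ p q : ℚ≥0, p ≤ q → L (p : ℝ≥0) ω ≤ L (q : ℝ≥0) ω := by
    rw [ae_all_iff]; intro p
    rw [ae_all_iff]; intro q
    by_cases hpq : p ≤ q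
    · filter_upwards [hL.increments_nonneg p q (by exact_mod_cast hpq)] with ω h _ using
        sub_nonneg.1 h
    · exact Eventually.of_forall fun _ h => absurd h hpq
  filter_upwards [h1, hL.cadlag] with ω h hc
  have key : ∀ s : ℝ≥0, ∃ u : ℕ → ℚ≥0, (∀ n, s < u n) ∧
      Tendsto (fun n => (u n : ℝ≥0)) atTop (𝓝[>] s) := by
    intro s
    have hex : ∀ n : ℕ, ∃ q : ℚ≥0, s < (q : ℝ≥0) ∧ (q : ℝ≥0) < s + 1 / ((n : ℝ≥0) + 1) := by
      intro n
      obtain ⟨q, hq1, hq2⟩ := exists_rat_btwn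
        (show (s : ℝ) < ((s + 1 / ((n : ℝ≥0) + 1) : ℝ≥0) : ℝ) by
          exact_mod_cast lt_add_of_pos_right s (by positivity))
      have hq0 : 0 ≤ q := by exact_mod_cast (s.2.trans hq1.le)
      lift q to ℚ≥0 using hq0
      exact ⟨q, by exact_mod_cast hq1, by exact_mod_cast hq2⟩
    choose u hu1 hu2 using hex
    refine ⟨u, hu1, tendsto_nhdsWithin_iff.2 ⟨?_, Eventually.of_forall hu1⟩⟩
    refine tendsto_of_tendsto_of_tendsto_of_le_of_le tendsto_const_nhds ?_
      (fun n => (hu1 n).le) (fun n => (hu2 n).le)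
    simpa using (tendsto_const_nhds (x := s)).add
      (tendsto_one_div_add_atTop_nhds_zero_nat (𝕜 := ℝ≥0))
  intro s t hst
  rcases hst.eq_or_lt with rfl | hlt
  · rfl
  obtain ⟨u, hu, hu'⟩ := key s
  obtain ⟨v, hv, hv'⟩ := key t
  have hus : ∀ᶠ n in atTop, (u n : ℝ≥0) < t :=
    (hu'.mono_right nhdsWithin_le_nhds).eventually (gt_mem_nhds hlt)
  refine le_of_tendsto_of_tendsto ((hc s).1.tendsto.comp hu') ((hc t).1.tendsto.comp hv') ?_
  filter_upwards [hus] with n hn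
  exact h _ _ (by exact_mod_cast (hn.trans (hv n)).le)

lemma IsOneSidedLevyProcess.aemeasurable_greatestFlight (hL : IsOneSidedLevyProcess L P)
    (t : ℝ≥0) : AEMeasurable (greatestFlight L t) P := by
  refine aemeasurable_of_tendsto_metrizable_ae atTop
    (fun n => (measurable_gridMax hL.measurable t n).aemeasurable) ?_
  filter_upwards [hL.ae_monotone, hL.cadlag] with ω hm hc
  exact tendsto_gridMax hm fun s => (hc s).1

end process

/-! ### Method of moments on [0, 1]. -/

section moments

variable {σ : Measure ℝ} {f : ℝ → ℝ}

/-- The factor `1 - u` absorbs the singularity of the measure at 1; the divided difference left over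
is continuous, so Weierstrass applies to it. -/
lemma exists_forall_sub_eq_mul (hf : Continuous f) (hd : DifferentiableAt ℝ f 1) :
    ∃ h : ℝ → ℝ, Continuous h ∧ ∀ u, f 1 - f u = (1 - u) * h u := by
  refine ⟨dslope f 1, ?_, fun u => ?_⟩
  · rw [← continuousOn_univ, continuousOn_dslope univ_mem]
    exact ⟨hf.continuousOn, hd⟩
  · have := sub_smul_dslope f 1 u
    rw [smul_eq_mul] at this
    linarith

lemma integrable_const_sub_of_integrable_one_sub (hσ : ∀ᵐ u ∂σ, u ∈ Icc (0 : ℝ) 1)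
    (hint : Integrable (fun u => 1 - u) σ) (hf : Continuous f) (hd : DifferentiableAt ℝ f 1) :
    Integrable (fun u => f 1 - f u) σ := by
  obtain ⟨h, hh, hfh⟩ := exists_forall_sub_eq_mul hf hd
  obtain ⟨C, hC⟩ := (isCompact_Icc (a := (0 : ℝ)) (b := 1)).exists_bound_of_continuousOn
    hh.continuousOn
  refine (hint.mul_const C).mono (continuous_const.sub hf).aestronglyMeasurable ?_
  filter_upwards [hσ] with u hu
  rw [hfh, norm_mul, norm_mul]
  exact mul_le_mul_of_nonneg_left ((hC u hu).trans (le_abs_self C)) (norm_nonneg _)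

lemma abs_integral_sub_integral_le {p h : ℝ → ℝ} {δ : ℝ} (hσ : ∀ᵐ u ∂σ, u ∈ Icc (0 : ℝ) 1)
    (hint : Integrable (fun u => 1 - u) σ)
    (hp : Integrable (fun u => (1 - u) * p u) σ) (hh : Integrable (fun u => (1 - u) * h u) σ)
    (hδ : ∀ u ∈ Icc (0 : ℝ) 1, |p u - h u| < δ) :
    |∫ u, (1 - u) * p u ∂σ - ∫ u, (1 - u) * h u ∂σ| ≤ δ * ∫ u, 1 - u ∂σ := by
  rw [← integral_sub hp hh, ← integral_const_mul, ← Real.norm_eq_abs]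
  refine norm_integral_le_of_norm_le (hint.const_mul δ) ?_
  filter_upwards [hσ] with u hu
  rw [← mul_sub, Real.norm_eq_abs, abs_mul, abs_of_nonneg (sub_nonneg.2 hu.2), mul_comm]
  exact mul_le_mul_of_nonneg_right (hδ u hu).le (sub_nonneg.2 hu.2)

/-- The method of moments for measures on `[0, 1]` with a possible singularity at `1`. -/
theorem tendsto_integral_sub_of_tendsto_moments {μ : ℕ → Measure ℝ} [∀ n, IsFiniteMeasure (μ n)]
    {c : ℕ → ℝ} (hc : ∀ n, 0 ≤ c n) (hμ : ∀ n, ∀ᵐ u ∂(μ n), u ∈ Icc (0 : ℝ) 1)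
    (hσ : ∀ᵐ u ∂σ, u ∈ Icc (0 : ℝ) 1) (hint : Integrable (fun u => 1 - u) σ)
    (hmom : ∀ k : ℕ, Tendsto (fun n => c n * ∫ u, 1 - u ^ k ∂(μ n)) atTop
      (𝓝 (∫ u, 1 - u ^ k ∂σ)))
    (hf : Continuous f) (hd : DifferentiableAt ℝ f 1) :
    Tendsto (fun n => c n * ∫ u, f 1 - f u ∂(μ n)) atTop (𝓝 (∫ u, f 1 - f u ∂σ)) := by
  have hintμ : ∀ n, Integrable (fun u : ℝ => 1 - u) (μ n) := fun n => by
    refine Integrable.of_bound (by fun_prop) 1 ?_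
    filter_upwards [hμ n] with u hu
    rw [Real.norm_eq_abs, abs_le]
    constructor <;> linarith [hu.1, hu.2]
  have hpoly : ∀ q : Polynomial ℝ, Tendsto (fun n => c n * ∫ u, q.eval 1 - q.eval u ∂(μ n)) atTop
      (𝓝 (∫ u, q.eval 1 - q.eval u ∂σ)) := by
    intro q
    induction q using Polynomial.induction_on' with
    | add p q hp hq =>
      have key : ∀ ν : Measure ℝ, (∀ᵐ u ∂ν, u ∈ Icc (0 : ℝ) 1) →
          Integrable (fun u => 1 - u) ν → ∫ u, (p + q).eval 1 - (p + q).eval u ∂ν =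
            ∫ u, p.eval 1 - p.eval u ∂ν + ∫ u, q.eval 1 - q.eval u ∂ν := by
        intro ν h1 h2
        rw [← integral_add
          (integrable_const_sub_of_integrable_one_sub h1 h2 p.continuous p.differentiableAt)
          (integrable_const_sub_of_integrable_one_sub h1 h2 q.continuous q.differentiableAt)]
        congr 1 with u
        simp only [Polynomial.eval_add]
        ring
      rw [key σ hσ hint]
      refine (hp.add hq).congr fun n => ?_
      rw [key (μ n) (hμ n) (hintμ n), mul_add]
    | monomial k a =>
      have key : ∀ ν : Measure ℝ, ∫ u, (Polynomial.monomial k a).eval 1 -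
          (Polynomial.monomial k a).eval u ∂ν = a * ∫ u, 1 - u ^ k ∂ν := by
        intro ν
        rw [← integral_const_mul]
        congr 1 with u
        simp only [Polynomial.eval_monomial, one_pow]
        ring
      rw [key]
      refine ((hmom k).const_mul a).congr fun n => ?_
      rw [key]
      ring
  obtain ⟨h, hh, hfh⟩ := exists_forall_sub_eq_mul hf hd
  have hA := hmom 1
  simp only [pow_one] at hA
  set A := ∫ u, 1 - u ∂σ with hAdef
  have hA0 : 0 ≤ A := integral_nonneg_of_ae (by
    filter_upwards [hσ] with u hu using sub_nonneg.2 hu.2)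
  rw [Metric.tendsto_nhds]
  intro ε hε
  -- Approximating the divided difference within δ costs at most δ A under σ and δ (A + 1) under the
  -- scaled `μ n` for large n; this δ makes the two costs sum to ε / 2.
  set δ := ε / (2 * (2 * A + 1)) with hδdef
  have hδ : 0 < δ := by positivity
  obtain ⟨p, hp⟩ := exists_polynomial_near_of_continuousOn 0 1 h hh.continuousOn δ hδ
  -- The factor X - 1 makes the increment of q at 1 equal to `(1 - u) * p.eval u`, matching the
  -- factorisation of f.
  set q : Polynomial ℝ := (Polynomial.X - 1) * p with hq
  have hqp : ∀ u, q.eval 1 - q.eval u = (1 - u) * p.eval u := fun u => by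
    simp [hq]
    ring
  have happrox : ∀ ν : Measure ℝ, (∀ᵐ u ∂ν, u ∈ Icc (0 : ℝ) 1) →
      Integrable (fun u => 1 - u) ν →
      |∫ u, q.eval 1 - q.eval u ∂ν - ∫ u, f 1 - f u ∂ν| ≤ δ * ∫ u, 1 - u ∂ν := by
    intro ν h1 h2
    have i1 := integrable_const_sub_of_integrable_one_sub h1 h2 q.continuous q.differentiableAt
    have i2 := integrable_const_sub_of_integrable_one_sub h1 h2 hf hd
    simp only [hqp, hfh] at i1 i2 ⊢
    exact abs_integral_sub_integral_le h1 h2 i1 i2 hp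
  filter_upwards [Metric.tendsto_nhds.1 (hpoly q) (ε / 2) (half_pos hε),
    hA.eventually (gt_mem_nhds (lt_add_one A))] with n hn1 hn2
  have h1 := happrox σ hσ hint
  have h2 := mul_le_mul_of_nonneg_left (happrox (μ n) (hμ n) (hintμ n)) (hc n)
  rw [← abs_of_nonneg (hc n), ← abs_mul, abs_of_nonneg (hc n)] at h2
  rw [Real.dist_eq] at hn1 ⊢
  have h3 : δ * (c n * ∫ u, 1 - u ∂(μ n)) ≤ δ * (A + 1) :=
    mul_le_mul_of_nonneg_left hn2.le hδ.le
  have h4 : δ * A + δ * (A + 1) = ε / 2 := by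
    rw [hδdef]
    field_simp
    ring
  rw [abs_lt] at hn1 ⊢
  rw [abs_le] at h1 h2
  constructor <;> nlinarith [h1.1, h1.2, h2.1, h2.2, hn1.1, hn1.2]

end moments

/-- A finite measure on `[0, 1]` is determined by its moments. -/
lemma ext_of_moments {μ ν : Measure ℝ} [IsFiniteMeasure μ] [IsFiniteMeasure ν]
    (hμ : ∀ᵐ u ∂μ, u ∈ Icc (0 : ℝ) 1) (hν : ∀ᵐ u ∂ν, u ∈ Icc (0 : ℝ) 1)
    (hmom : ∀ k : ℕ, ∫ u, u ^ k ∂μ = ∫ u, u ^ k ∂ν) : μ = ν := by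
  have hint : ∀ (ρ : Measure ℝ) [IsFiniteMeasure ρ], (∀ᵐ u ∂ρ, u ∈ Icc (0 : ℝ) 1) →
      ∀ g : ℝ → ℝ, Continuous g → Integrable g ρ := by
    intro ρ _ hρ g hg
    obtain ⟨C, hC⟩ := (isCompact_Icc (a := (0 : ℝ)) (b := 1)).exists_bound_of_continuousOn
      hg.continuousOn
    refine Integrable.of_bound hg.aestronglyMeasurable C ?_
    filter_upwards [hρ] with u hu using hC u hu
  have hpoly : ∀ q : Polynomial ℝ, ∫ u, q.eval u ∂μ = ∫ u, q.eval u ∂ν := by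
    intro q
    induction q using Polynomial.induction_on' with
    | add p q hp hq =>
      simp only [Polynomial.eval_add]
      rw [integral_add (hint μ hμ _ p.continuous) (hint μ hμ _ q.continuous),
        integral_add (hint ν hν _ p.continuous) (hint ν hν _ q.continuous), hp, hq]
    | monomial k a => simp only [Polynomial.eval_monomial, integral_const_mul, hmom]
  refine ext_of_forall_integral_eq_of_IsFiniteMeasure fun f => ?_
  refine eq_of_forall_dist_le fun ε hε => ?_
  set m := μ.real univ + ν.real univ + 1 with hm
  have hm0 : 0 < m := by positivity
  obtain ⟨p, hp⟩ := exists_polynomial_near_of_continuousOn 0 1 f f.continuous.continuousOn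
    (ε / m) (by positivity)
  have key : ∀ (ρ : Measure ℝ) [IsFiniteMeasure ρ], (∀ᵐ u ∂ρ, u ∈ Icc (0 : ℝ) 1) →
      |∫ u, p.eval u ∂ρ - ∫ u, f u ∂ρ| ≤ ε / m * ρ.real univ := by
    intro ρ _ hρ
    rw [← integral_sub (hint ρ hρ _ p.continuous) (hint ρ hρ _ f.continuous), ← Real.norm_eq_abs]
    refine norm_integral_le_of_norm_le_const ?_
    filter_upwards [hρ] with u hu using (hp u hu).le
  have h1 := key μ hμ
  have h2 := key ν hν
  have h3 : ε / m * μ.real univ + ε / m * ν.real univ ≤ ε := by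
    rw [← mul_add, div_mul_eq_mul_div, div_le_iff₀ hm0]
    exact mul_le_mul_of_nonneg_left (by linarith) hε.le
  rw [hpoly p] at h1
  rw [Real.dist_eq, abs_le]
  rw [abs_le] at h1 h2
  constructor <;> linarith [h1.1, h1.2, h2.1, h2.2]

/-! ### Lévy measures in the variable u = exp(-x). -/

/-- The image under `x ↦ exp (-x)` of a Lévy measure restricted to `(0, ∞)`. -/
noncomputable def expImage (lam : Measure ℝ) : Measure ℝ :=
  (lam.restrict (Ioi 0)).map fun x => Real.exp (-x)

section expImage

variable {lam : Measure ℝ}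

lemma measurableEmbedding_exp_neg : MeasurableEmbedding fun x : ℝ => Real.exp (-x) :=
  (Real.continuous_exp.comp continuous_neg).measurableEmbedding
    (Real.exp_injective.comp neg_injective)

lemma integral_expImage (g : ℝ → ℝ) :
    ∫ u, g u ∂(expImage lam) = ∫ x in Ioi 0, g (Real.exp (-x)) ∂lam :=
  measurableEmbedding_exp_neg.integral_map g

lemma ae_expImage_mem : ∀ᵐ u ∂(expImage lam), u ∈ Icc (0 : ℝ) 1 := by
  rw [expImage, measurableEmbedding_exp_neg.ae_map_iff]
  filter_upwards [ae_restrict_mem measurableSet_Ioi] with x hx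
  exact ⟨(Real.exp_pos _).le, Real.exp_le_one_iff.2 (by simpa using (mem_Ioi.1 hx).le)⟩

lemma IsOneSidedLevyMeasure.integrable_min (h : IsOneSidedLevyMeasure lam) :
    Integrable (fun x => min x 1) (lam.restrict (Ioi 0)) := by
  refine ⟨by fun_prop, ?_⟩
  rw [hasFiniteIntegral_iff_ofReal]
  · exact h.integrability
  · filter_upwards [ae_restrict_mem measurableSet_Ioi] with x hx
    exact le_min (mem_Ioi.1 hx).le zero_le_one

lemma IsOneSidedLevyMeasure.integrable_one_sub_exp (h : IsOneSidedLevyMeasure lam) :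
    Integrable (fun x => 1 - Real.exp (-x)) (lam.restrict (Ioi 0)) := by
  refine h.integrable_min.mono (by fun_prop) ?_
  filter_upwards [ae_restrict_mem measurableSet_Ioi] with x hx
  have h0 : 0 < x := hx
  have h1 : Real.exp (-x) ≤ 1 := Real.exp_le_one_iff.2 (by linarith)
  rw [Real.norm_of_nonneg (by linarith), Real.norm_of_nonneg (le_min h0.le zero_le_one)]
  exact le_min (by linarith [Real.add_one_le_exp (-x)]) (by linarith [Real.exp_pos (-x)])

lemma IsOneSidedLevyMeasure.integrable_expImage (h : IsOneSidedLevyMeasure lam) :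
    Integrable (fun u => 1 - u) (expImage lam) :=
  measurableEmbedding_exp_neg.integrable_map_iff.2 h.integrable_one_sub_exp

/-- The Laplace exponent at integers thus supplies the moments that the method of moments requires.
-/
lemma integral_one_sub_pow_expImage (k : ℕ) :
    ∫ u, 1 - u ^ k ∂(expImage lam) = levyCharacteristic lam k := by
  rw [integral_expImage, levyCharacteristic]
  congr 1 with x
  rw [← Real.exp_nat_mul]
  ring_nf

end expImage

/-! ### Continuous cutoffs approximating the indicator of u > z. -/

/-- The continuous piecewise linear cutoff `u ↦ a + k (u - z)` clamped to `[0, 1]`. -/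
noncomputable def rampCutoff (a z k u : ℝ) : ℝ := max 0 (min 1 (a + k * (u - z)))

section rampCutoff

variable {a z k u : ℝ}

lemma continuous_rampCutoff : Continuous (rampCutoff a z k) := by
  unfold rampCutoff; fun_prop

lemma rampCutoff_nonneg : 0 ≤ rampCutoff a z k u := le_max_left _ _

lemma rampCutoff_le_one : rampCutoff a z k u ≤ 1 := max_le zero_le_one (min_le_left _ _)

lemma rampCutoff_eq_zero (h : a + k * (u - z) ≤ 0) : rampCutoff a z k u = 0 :=
  max_eq_left ((min_le_right _ _).trans h)

lemma rampCutoff_eq_one (h : 1 ≤ a + k * (u - z)) : rampCutoff a z k u = 1 := by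
  simp [rampCutoff, min_eq_left h]

/-- A lower bound common to all steeper ramps; it provides the dominating function when the slope
tends to infinity. -/
lemma rampCutoff_zero_le {k₀ : ℝ} (ha : 0 ≤ a) (hk₀ : 0 ≤ k₀) (hk : k₀ ≤ k) :
    rampCutoff 0 z k₀ u ≤ rampCutoff a z k u := by
  rcases le_total u z with h | h
  · rw [rampCutoff_eq_zero (by nlinarith)]
    exact rampCutoff_nonneg
  · refine max_le_max le_rfl (min_le_min le_rfl ?_)
    nlinarith [mul_le_mul_of_nonneg_right hk (sub_nonneg.2 h)]

lemma tendsto_rampCutoff (h : u ≠ z) :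
    Tendsto (fun k : ℕ => rampCutoff a z k u) atTop (𝓝 ((Ioi z).indicator 1 u)) := by
  refine tendsto_const_nhds.congr' ?_
  rcases h.lt_or_gt with h | h
  · have := (tendsto_natCast_atTop_atTop (R := ℝ)).atTop_mul_const_of_neg (sub_neg.2 h)
    filter_upwards [this.eventually (eventually_le_atBot (-a))] with k hk
    rw [rampCutoff_eq_zero (by linarith), indicator_of_notMem (by simpa using h.le)]
  · have := (tendsto_natCast_atTop_atTop (R := ℝ)).atTop_mul_const (sub_pos.2 h)
    filter_upwards [this.eventually (eventually_ge_atTop (1 - a))] with k hk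
    rw [rampCutoff_eq_one (by linarith), indicator_of_mem (by simpa using h), Pi.one_apply]

end rampCutoff

section rpowCutoff

variable {a z w : ℝ}

lemma continuous_rpow_mul_rampCutoff (hw : 0 ≤ w) (k : ℝ) :
    Continuous fun u => u ^ w * rampCutoff a z k u :=
  (Real.continuous_rpow_const hw).mul continuous_rampCutoff

lemma differentiableAt_rpow_mul_rampCutoff {k : ℝ} (hk : 1 < a + k * (1 - z)) :
    DifferentiableAt ℝ (fun u => u ^ w * rampCutoff a z k u) 1 := by
  have h1 : DifferentiableAt ℝ (fun u : ℝ => u ^ w) 1 :=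
    Real.differentiableAt_rpow_const_of_ne w one_ne_zero
  refine h1.congr_of_eventuallyEq ?_
  have h2 : ContinuousAt (fun u : ℝ => a + k * (u - z)) 1 := by fun_prop
  filter_upwards [h2.eventually (lt_mem_nhds hk)] with u hu
  rw [rampCutoff_eq_one hu.le, mul_one]

/-- Dominated convergence. Taking `k₀ > 1 / (1 - z)` makes the reference ramp equal to 1 near u = 1,
so the dominating function is integrable although σ may be infinite there. At u = z the ramps do not
converge to the indicator in general, hence the condition on `{z}`. -/
lemma tendsto_integral_one_sub_rpow_mul_rampCutoff {σ : Measure ℝ}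
    (hσ : ∀ᵐ u ∂σ, u ∈ Icc (0 : ℝ) 1) (hint : Integrable (fun u => 1 - u) σ) (hz : z < 1)
    (hσz : σ {z} = 0) (ha : 0 ≤ a) (hw : 0 ≤ w) :
    Tendsto (fun k : ℕ => ∫ u, 1 - u ^ w * rampCutoff a z k u ∂σ) atTop
      (𝓝 (∫ u, 1 - (Ioi z).indicator (fun u => u ^ w) u ∂σ)) := by
  obtain ⟨k₀, hk₀⟩ := exists_nat_gt (1 / (1 - z))
  rw [div_lt_iff₀ (sub_pos.2 hz)] at hk₀
  have hb : Integrable (fun u => 1 - u ^ w * rampCutoff 0 z k₀ u) σ := by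
    have := integrable_const_sub_of_integrable_one_sub hσ hint
      (continuous_rpow_mul_rampCutoff (a := 0) (z := z) hw k₀)
      (differentiableAt_rpow_mul_rampCutoff (by linarith))
    simpa [rampCutoff_eq_one (show (1 : ℝ) ≤ 0 + k₀ * (1 - z) by linarith)] using this
  refine tendsto_integral_filter_of_dominated_convergence _ ?_ ?_ hb ?_
  · exact Eventually.of_forall fun k =>
      (continuous_const.sub (continuous_rpow_mul_rampCutoff hw k)).aestronglyMeasurable
  · filter_upwards [eventually_ge_atTop k₀] with k hk
    filter_upwards [hσ] with u hu
    have h1 : 0 ≤ u ^ w := Real.rpow_nonneg hu.1 w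
    have h2 : u ^ w ≤ 1 := Real.rpow_le_one hu.1 hu.2 hw
    have h3 : rampCutoff 0 z k₀ u ≤ rampCutoff a z k u :=
      rampCutoff_zero_le ha k₀.cast_nonneg (by exact_mod_cast hk)
    rw [Real.norm_of_nonneg]
    · linarith [mul_le_mul_of_nonneg_left h3 h1]
    · linarith [mul_le_one₀ h2 rampCutoff_nonneg (rampCutoff_le_one (a := a) (z := z) (k := k)
        (u := u))]
  · have : ∀ᵐ u ∂σ, u ≠ z := by simpa [ae_iff] using hσz
    filter_upwards [this] with u hu
    have h := ((tendsto_rampCutoff (a := a) hu).const_mul (u ^ w)).const_sub 1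
    convert h using 2
    by_cases hm : u ∈ Ioi z <;> simp [hm]

end rpowCutoff

/-! ### Truncated Laplace transform for a general Lévy measure. -/

section process

variable {Ω : Type*} [MeasurableSpace Ω] {L : ℝ≥0 → Ω → ℝ} {P : Measure Ω} {lam : Measure ℝ}

lemma IsLevyProcess.integral_prod_increments (hL : IsLevyProcess L P) (t : ℝ≥0) (n : ℕ)
    {F : ℝ → ℝ} (hF : Measurable F) :
    ∫ ω, ∏ i ∈ Finset.range (n + 1), F (L (gridPoint t n (i + 1)) ω - L (gridPoint t n i) ω) ∂P
      = (∫ ω, F (L (t / (n + 1)) ω) ∂P) ^ (n + 1) := by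
  have hind := hL.indep_increments (n + 1) (fun i => gridPoint t n i)
    ((gridPoint_mono t n).comp Fin.val_strictMono.monotone)
  have h := hind.integral_fun_prod_comp (f := fun _ => F)
    (fun i => ((hL.measurable _).sub (hL.measurable _)).aemeasurable)
    (fun i => hF.aestronglyMeasurable)
  have hid : ∀ i : Fin (n + 1), ∫ ω, F (L (gridPoint t n (i.succ : Fin (n + 2))) ω -
      L (gridPoint t n (i.castSucc : Fin (n + 2))) ω) ∂P = ∫ ω, F (L (t / (n + 1)) ω) ∂P := by
    intro i
    have h1 := ((hL.stationary_increments (gridPoint t n i) 0 (t / (n + 1))).comp hF).integral_eq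
    simp only [Function.comp_apply, Pi.sub_apply, zero_add, ← gridPoint_succ] at h1
    simp only [Fin.val_succ, Fin.val_castSucc, h1]
    refine integral_congr_ae ?_
    filter_upwards [hL.zero] with ω hω
    rw [hω, sub_zero]
  simp only [hid, Finset.prod_const, Finset.card_univ, Fintype.card_fin] at h
  rw [← h]
  congr 1 with ω
  rw [Finset.prod_range]
  rfl

lemma tendsto_mul_one_sub_exp (ψ : ℝ) {t : ℝ} (ht : 0 < t) :
    Tendsto (fun n : ℕ => (n + 1) / t * (1 - Real.exp (-ψ * (t / (n + 1))))) atTop (𝓝 ψ) := by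
  have h1 : HasDerivAt (fun x : ℝ => Real.exp (-ψ * x)) (-ψ) 0 := by
    simpa using ((hasDerivAt_id (0 : ℝ)).const_mul (-ψ)).exp
  have h2 : Tendsto (fun n : ℕ => t / ((n : ℝ) + 1)) atTop (𝓝[≠] 0) := by
    refine tendsto_nhdsWithin_iff.2 ⟨?_, Eventually.of_forall fun n => ?_⟩
    · simpa [div_eq_mul_inv] using
        (tendsto_one_div_add_atTop_nhds_zero_nat (𝕜 := ℝ)).const_mul t
    · exact (by positivity : (0 : ℝ) < t / (n + 1)).ne'
  have h3 := ((hasDerivAt_iff_tendsto_slope_zero.1 h1).comp h2).neg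
  rw [neg_neg] at h3
  refine h3.congr fun n => ?_
  simp only [Function.comp_apply, zero_add, mul_zero, Real.exp_zero, smul_eq_mul, inv_div]
  ring

lemma IsOneSidedLevyProcess.ae_nonneg (hL : IsOneSidedLevyProcess L P) (t : ℝ≥0) :
    ∀ᵐ ω ∂P, 0 ≤ L t ω := by
  filter_upwards [hL.zero, hL.increments_nonneg 0 t zero_le] with ω h0 h
  rwa [h0, sub_zero] at h

/-- The method of moments, applied to the laws of exp(-L(t/(n+1))) weighted by (n+1)/t, shows that
(n+1)(E f - 1) converges; the power then converges to the exponential of the limit. -/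
lemma tendsto_integral_pow [IsProbabilityMeasure P]
    (hL : IsOneSidedLevyProcess L P) (hlam : HasLevyMeasure L P lam)
    {t : ℝ≥0} (ht : 0 < t) {f : ℝ → ℝ} (hf : Continuous f) (hd : DifferentiableAt ℝ f 1)
    (hf1 : f 1 = 1) :
    Tendsto (fun n : ℕ => (∫ ω, f (Real.exp (-L (t / (n + 1)) ω)) ∂P) ^ (n + 1)) atTop
      (𝓝 (Real.exp (-t * ∫ u, 1 - f u ∂(expImage lam)))) := by
  have ht' : (0 : ℝ) < t := ht
  have hm : ∀ s, Measurable fun ω => Real.exp (-L s ω) := fun s => (hL.measurable s).neg.exp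
  have hmem : ∀ s, ∀ᵐ u ∂(P.map fun ω => Real.exp (-L s ω)), u ∈ Icc (0 : ℝ) 1 := by
    intro s
    refine (ae_map_iff (hm s).aemeasurable measurableSet_Icc).2 ?_
    filter_upwards [hL.ae_nonneg s] with ω hω
    exact ⟨(Real.exp_pos _).le, Real.exp_le_one_iff.2 (by linarith)⟩
  have hpr : ∀ s, IsProbabilityMeasure (P.map fun ω => Real.exp (-L s ω)) := fun s =>
    Measure.isProbabilityMeasure_map (hm s).aemeasurable
  have hint : ∀ s {g : ℝ → ℝ}, Continuous g →
      Integrable g (P.map fun ω => Real.exp (-L s ω)) := by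
    intro s g hg
    obtain ⟨C, hC⟩ := (isCompact_Icc (a := (0 : ℝ)) (b := 1)).exists_bound_of_continuousOn
      hg.continuousOn
    refine Integrable.of_bound hg.aestronglyMeasurable C ?_
    filter_upwards [hmem s] with u hu using hC u hu
  have hsub : ∀ s {g : ℝ → ℝ}, Continuous g →
      ∫ u, 1 - g u ∂(P.map fun ω => Real.exp (-L s ω)) =
        1 - ∫ ω, g (Real.exp (-L s ω)) ∂P := by
    intro s g hg
    rw [integral_sub (integrable_const 1) (hint s hg), integral_map (hm s).aemeasurable
      hg.aestronglyMeasurable]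
    simp
  have key := tendsto_integral_sub_of_tendsto_moments
    (μ := fun n : ℕ => P.map fun ω => Real.exp (-L (t / (n + 1)) ω))
    (c := fun n : ℕ => ((n : ℝ) + 1) / t) (fun n => by positivity) (fun n => hmem _)
    (ae_expImage_mem (lam := lam)) hlam.levy_measure.integrable_expImage ?_ hf hd
  · rw [hf1] at key
    have h2 : Tendsto (fun n : ℕ => ((n + 1 : ℕ) : ℝ) *
        (∫ ω, f (Real.exp (-L (t / ((n + 1 : ℕ) : ℝ≥0)) ω)) ∂P - 1)) atTop
        (𝓝 (-t * ∫ u, 1 - f u ∂(expImage lam))) := by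
      refine (key.const_mul (-(t : ℝ))).congr fun n => ?_
      rw [hsub _ hf]
      push_cast
      field_simp
      ring
    have h3 := Real.tendsto_one_add_pow_exp_of_tendsto ((tendsto_add_atTop_iff_nat
      (f := fun m : ℕ => (m : ℝ) *
        (∫ ω, f (Real.exp (-L (t / (m : ℝ≥0)) ω)) ∂P - 1)) 1).1 h2)
    refine (h3.comp (tendsto_add_atTop_nat 1)).congr fun n => ?_
    simp
  · intro k
    rw [integral_one_sub_pow_expImage]
    refine (tendsto_mul_one_sub_exp _ ht').congr fun n => ?_
    rw [hsub _ (continuous_pow k)]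
    congr 2
    have := hlam.laplace (t / (n + 1)) k k.cast_nonneg
    push_cast at this
    rw [← this]
    congr 1 with ω
    rw [← Real.exp_nat_mul]
    ring_nf

/-- The joint law of `L t` and of the greatest flight, as a truncated Laplace transform. -/
theorem integral_exp_greatestFlight_le [IsProbabilityMeasure P]
    (hL : IsOneSidedLevyProcess L P)
    (hlam : HasLevyMeasure L P lam) {t : ℝ≥0} (ht : 0 < t) {x w : ℝ} (hx : 0 < x) (hw : 0 ≤ w)
    (hx0 : lam {x} = 0) :
    ∫ ω in {ω | greatestFlight L t ω ≤ x}, Real.exp (-w * L t ω) ∂P =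
      Real.exp (-t * ∫ y in Ioi 0, 1 - (Iio x).indicator (fun y => Real.exp (-w * y)) y ∂lam) := by
  set z := Real.exp (-x) with hz
  have hz1 : z < 1 := Real.exp_lt_one_iff.2 (by linarith)
  have hz0 : 0 < z := Real.exp_pos _
  have hσz : expImage lam {z} = 0 := by
    rw [expImage, measurableEmbedding_exp_neg.map_apply]
    refine measure_mono_null ?_ (nonpos_iff_eq_zero.1
      ((Measure.restrict_apply_le _ _).trans hx0.le))
    intro y hy
    simpa [hz] using hy
  have hrhs : ∫ u, 1 - (Ioi z).indicator (fun u => u ^ w) u ∂(expImage lam) =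
      ∫ y in Ioi 0, 1 - (Iio x).indicator (fun y => Real.exp (-w * y)) y ∂lam := by
    rw [integral_expImage]
    congr 1 with y
    by_cases hy : y < x
    · rw [indicator_of_mem (by simpa [hz] using hy), indicator_of_mem (by simpa using hy),
        ← Real.exp_mul]
      ring_nf
    · rw [indicator_of_notMem (by simpa [hz] using hy), indicator_of_notMem (by simpa using hy)]
  rw [← hrhs]
  have hlimk : ∀ a : ℝ, 0 ≤ a → Tendsto (fun k : ℕ =>
      Real.exp (-t * ∫ u, 1 - u ^ w * rampCutoff a z k u ∂(expImage lam))) atTop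
      (𝓝 (Real.exp (-t * ∫ u, 1 - (Ioi z).indicator (fun u => u ^ w) u ∂(expImage lam)))) :=
    fun a ha => ((tendsto_integral_one_sub_rpow_mul_rampCutoff ae_expImage_mem
      hlam.levy_measure.integrable_expImage hz1 hσz ha hw).const_mul _).rexp
  have hk1 : ∀ a : ℝ, 0 ≤ a → ∀ᶠ k : ℕ in atTop, 1 < a + k * (1 - z) := by
    intro a ha
    have := (tendsto_natCast_atTop_atTop (R := ℝ)).atTop_mul_const (sub_pos.2 hz1)
    filter_upwards [this.eventually (eventually_gt_atTop 1)] with k hk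
    linarith
  -- A smoothed version of exp(-w L(t)) on the event that no increment exceeds x, an increment y ≤ x
  -- meaning exp(-y) ≥ z. With a = 0 the ramp vanishes for u ≤ z, giving a lower bound; with a = 2
  -- it is 1 for u ≥ z - 1/k, giving an upper bound. First n, then k, tends to infinity.
  set Φ : ℝ → ℕ → ℕ → Ω → ℝ := fun a k n ω => Real.exp (-w * L t ω) *
    ∏ i ∈ Finset.range (n + 1), rampCutoff a z k
      (Real.exp (-(L (gridPoint t n (i + 1)) ω - L (gridPoint t n i) ω))) with hΦ
  have hprod : ∀ a k n, ∫ ω, Φ a k n ω ∂P =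
      (∫ ω, Real.exp (-L (t / (n + 1)) ω) ^ w *
        rampCutoff a z k (Real.exp (-L (t / (n + 1)) ω)) ∂P) ^ (n + 1) := by
    intro a k n
    rw [← hL.integral_prod_increments t n
      (F := fun y => Real.exp (-y) ^ w * rampCutoff a z k (Real.exp (-y)))
      (((continuous_rpow_mul_rampCutoff hw k).comp (by fun_prop)).measurable)]
    refine integral_congr_ae ?_
    filter_upwards [hL.zero] with ω hω
    rw [Finset.prod_mul_distrib]
    simp only [hΦ, ← Real.exp_mul]
    -- The factors exp(-y)^w of the increments telescope to exp(-w L(t)).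
    rw [← Real.exp_sum, ← Finset.sum_mul, Finset.sum_neg_distrib,
      Finset.sum_range_sub (fun i => L (gridPoint t n i) ω), gridPoint_last, gridPoint_zero, hω]
    ring_nf
  have hlimn : ∀ a : ℝ, 0 ≤ a → ∀ᶠ k : ℕ in atTop, Tendsto (fun n => ∫ ω, Φ a k n ω ∂P) atTop
      (𝓝 (Real.exp (-t * ∫ u, 1 - u ^ w * rampCutoff a z k u ∂(expImage lam)))) := by
    intro a ha
    filter_upwards [hk1 a ha] with k hk
    simp only [hprod]
    exact tendsto_integral_pow hL hlam ht (continuous_rpow_mul_rampCutoff hw k)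
      (differentiableAt_rpow_mul_rampCutoff hk) (by simp [rampCutoff_eq_one hk.le])
  have hS : NullMeasurableSet {ω | greatestFlight L t ω ≤ x} P :=
    nullMeasurableSet_le (hL.aemeasurable_greatestFlight t) aemeasurable_const
  have hexpm : Measurable fun ω => Real.exp (-w * L t ω) := ((hL.measurable t).const_mul _).exp
  have hexp1 : ∀ᵐ ω ∂P, Real.exp (-w * L t ω) ≤ 1 := by
    filter_upwards [hL.ae_nonneg t] with ω hω
    exact Real.exp_le_one_iff.2 (by nlinarith)
  have hexpi : Integrable (fun ω => Real.exp (-w * L t ω)) P := by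
    refine Integrable.of_bound hexpm.aestronglyMeasurable 1 ?_
    filter_upwards [hexp1] with ω hω
    rwa [Real.norm_of_nonneg (Real.exp_pos _).le]
  have hΦ0 : ∀ a k n ω, 0 ≤ Φ a k n ω := fun a k n ω =>
    mul_nonneg (Real.exp_pos _).le (Finset.prod_nonneg fun _ _ => rampCutoff_nonneg)
  have hΦle : ∀ a k n ω, Φ a k n ω ≤ Real.exp (-w * L t ω) := fun a k n ω =>
    mul_le_of_le_one_right (Real.exp_pos _).le
      (Finset.prod_le_one (fun _ _ => rampCutoff_nonneg) fun _ _ => rampCutoff_le_one)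
  have hΦm : ∀ a k n, Measurable (Φ a k n) := fun a k n =>
    hexpm.mul (Finset.measurable_fun_prod _ fun i _ => continuous_rampCutoff.measurable.comp
      ((hL.measurable _).sub (hL.measurable _)).neg.exp)
  have hΦi : ∀ a k n, Integrable (Φ a k n) P := fun a k n =>
    hexpi.mono (hΦm a k n).aestronglyMeasurable (Eventually.of_forall fun ω => by
      rw [Real.norm_of_nonneg (hΦ0 a k n ω), Real.norm_of_nonneg (Real.exp_pos _).le]
      exact hΦle a k n ω)
  refine le_antisymm ?_ ?_
  · refine ge_of_tendsto (hlimk 2 zero_le_two) ?_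
    have hkz : ∀ᶠ k : ℕ in atTop, 1 < k * z :=
      ((tendsto_natCast_atTop_atTop (R := ℝ)).atTop_mul_const hz0).eventually
        (eventually_gt_atTop 1)
    filter_upwards [hlimn 2 zero_le_two, hkz] with k hk hkz
    have hk0 : (0 : ℝ) < k := by
      by_contra hcon
      nlinarith
    -- The increment size at which u = z - 1/k. As x' > x, on the event X ≤ x all increments of a
    -- fine partition are below x', so every ramp factor is 1.
    set x' := -Real.log (z - 1 / k) with hx'
    have hzk : 0 < z - 1 / k := by
      rw [sub_pos, div_lt_iff₀ hk0]
      linarith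
    have hxx' : x < x' := by
      have : Real.log (z - 1 / k) < Real.log z :=
        Real.log_lt_log hzk (sub_lt_self _ (by positivity))
      rw [hz, Real.log_exp] at this
      linarith
    have hD : Tendsto (fun n => ∫ ω in {ω | greatestFlight L t ω ≤ x},
        {ω | gridMax (fun s => L s ω) t n < x'}.indicator
          (fun ω => Real.exp (-w * L t ω)) ω ∂P) atTop
        (𝓝 (∫ ω in {ω | greatestFlight L t ω ≤ x}, Real.exp (-w * L t ω) ∂P)) := by
      refine tendsto_integral_of_dominated_convergence _ (fun n => ?_) hexpi.integrableOn
        (fun n => ?_) ?_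
      · exact (hexpm.indicator (measurableSet_lt (measurable_gridMax hL.measurable t n)
          measurable_const)).aestronglyMeasurable
      · refine Eventually.of_forall fun ω => (norm_indicator_le_norm_self _ _).trans_eq ?_
        rw [Real.norm_of_nonneg (Real.exp_pos _).le]
      · have h2 := ae_restrict_mem₀ hS
        filter_upwards [ae_restrict_of_ae hL.ae_monotone, ae_restrict_of_ae hL.cadlag, h2]
          with ω hm hc hω
        refine tendsto_const_nhds.congr' ?_
        filter_upwards [eventually_gridMax_lt_of_greatestFlight_lt hm (fun s => (hc s).1)
          (lt_of_le_of_lt hω hxx')] with n hn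
        exact (indicator_of_mem (s := {ω | gridMax (fun s => L s ω) t n < x'}) hn
          (fun ω => Real.exp (-w * L t ω))).symm
    refine le_of_tendsto_of_tendsto' hD hk fun n => ?_
    refine le_trans (setIntegral_mono (hexpi.indicator (measurableSet_lt
      (measurable_gridMax hL.measurable t n) measurable_const)).integrableOn
      (hΦi 2 k n).integrableOn fun ω => ?_)
      (setIntegral_le_integral (hΦi 2 k n) (Eventually.of_forall (hΦ0 2 k n)))
    by_cases hω : ω ∈ {ω | gridMax (fun s => L s ω) t n < x'}
    · rw [indicator_of_mem hω, hΦ]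
      refine le_of_eq ?_
      dsimp only
      rw [Finset.prod_eq_one, mul_one]
      intro i hi
      refine rampCutoff_eq_one ?_
      have h1 := (gridMax_lt_iff.1 hω) i (Finset.mem_range.1 hi)
      have h2 : z - 1 / k ≤
          Real.exp (-(L (gridPoint t n (i + 1)) ω - L (gridPoint t n i) ω)) := by
        rw [← Real.exp_log hzk]
        exact Real.exp_le_exp.2 (by linarith)
      have h3 : (k : ℝ) * (1 / k) = 1 := by field_simp
      nlinarith
    · rw [indicator_of_notMem hω]
      exact hΦ0 2 k n ω
  · refine le_of_tendsto (hlimk 0 le_rfl) ?_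
    filter_upwards [hlimn 0 le_rfl] with k hk
    refine le_of_tendsto' hk fun n => ?_
    rw [← integral_indicator₀ hS]
    refine integral_mono_ae (hΦi 0 k n) (hexpi.indicator₀ hS) ?_
    filter_upwards [hL.ae_monotone] with ω hm
    by_cases hω : ω ∈ {ω | greatestFlight L t ω ≤ x}
    · rw [indicator_of_mem hω]
      exact hΦle 0 k n ω
    · rw [indicator_of_notMem hω]
      -- When X > x some increment exceeds x on every partition, and its ramp factor kills the
      -- product; no limit in n is needed for this comparison.
      have h1 : ¬ gridMax (fun s => L s ω) t n ≤ x := fun h =>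
        hω ((greatestFlight_le_gridMax hm n).trans h)
      rw [gridMax_le_iff] at h1
      push Not at h1
      obtain ⟨i, hi, hix⟩ := h1
      refine le_of_eq (mul_eq_zero_of_right _
        (Finset.prod_eq_zero (Finset.mem_range.2 hi) (rampCutoff_eq_zero ?_)))
      have h2 : Real.exp (-(L (gridPoint t n (i + 1)) ω - L (gridPoint t n i) ω)) ≤ z :=
        Real.exp_le_exp.2 (by linarith)
      have h3 : (0 : ℝ) ≤ k := k.cast_nonneg
      nlinarith

end process

/-! ### The selfsimilar Lévy measure and the function G. -/

section selfsimilarLevyMeasure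

variable {α : ℝ}

lemma selfsimilarLevyMeasure_restrict {s : Set ℝ} (hs : MeasurableSet s) (hs0 : s ⊆ Ioi 0) :
    (selfsimilarLevyMeasure α).restrict s =
      (volume.restrict s).withDensity fun x => ENNReal.ofReal (α / x ^ (1 + α)) := by
  rw [selfsimilarLevyMeasure, restrict_withDensity hs, Measure.restrict_restrict hs,
    inter_eq_self_of_subset_left hs0]

lemma measurable_selfsimilarDensity :
    Measurable fun x : ℝ => ENNReal.ofReal (α / x ^ (1 + α)) := by fun_prop

lemma toReal_selfsimilarDensity (hα : 0 ≤ α) {x : ℝ} (hx : 0 < x) :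
    (ENNReal.ofReal (α / x ^ (1 + α))).toReal = α / x ^ (1 + α) :=
  ENNReal.toReal_ofReal (by positivity)

lemma setIntegral_selfsimilarLevyMeasure (hα : 0 ≤ α) {s : Set ℝ} (hs : MeasurableSet s)
    (hs0 : s ⊆ Ioi 0) (g : ℝ → ℝ) :
    ∫ x in s, g x ∂(selfsimilarLevyMeasure α) = ∫ x in s, g x * (α / x ^ (1 + α)) := by
  rw [selfsimilarLevyMeasure_restrict hs hs0, integral_withDensity_eq_integral_toReal_smul
    measurable_selfsimilarDensity (Eventually.of_forall fun _ => ENNReal.ofReal_lt_top)]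
  refine setIntegral_congr_fun hs fun x hx => ?_
  simp only [toReal_selfsimilarDensity hα (hs0 hx), smul_eq_mul, mul_comm]

lemma integrableOn_selfsimilarLevyMeasure_iff (hα : 0 ≤ α) {s : Set ℝ} (hs : MeasurableSet s)
    (hs0 : s ⊆ Ioi 0) (g : ℝ → ℝ) :
    IntegrableOn g s (selfsimilarLevyMeasure α) ↔
      IntegrableOn (fun x => g x * (α / x ^ (1 + α))) s := by
  rw [IntegrableOn, selfsimilarLevyMeasure_restrict hs hs0, integrable_withDensity_iff
    measurable_selfsimilarDensity (Eventually.of_forall fun _ => ENNReal.ofReal_lt_top)]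
  refine integrable_congr ?_
  filter_upwards [ae_restrict_mem hs] with x hx
  rw [toReal_selfsimilarDensity hα (hs0 hx)]

lemma selfsimilarLevyMeasure_singleton (x : ℝ) : selfsimilarLevyMeasure α {x} = 0 :=
  withDensity_absolutelyContinuous _ _ (by simp)

lemma pow_mul_selfsimilarDensity (k : ℕ) {x : ℝ} (hx : 0 < x) :
    x ^ k * (α / x ^ (1 + α)) = α * x ^ (k - 1 - α : ℝ) := by
  rw [show (k - 1 - α : ℝ) = k - (1 + α) by ring, Real.rpow_sub hx, Real.rpow_natCast]
  ring

lemma integrableOn_pow_selfsimilarLevyMeasure (hα0 : 0 ≤ α) (hα1 : α < 1) {k : ℕ} (hk : 1 ≤ k)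
    (x : ℝ) : IntegrableOn (fun u => u ^ k) (Ioc 0 x) (selfsimilarLevyMeasure α) := by
  have hk' : (1 : ℝ) ≤ k := by exact_mod_cast hk
  rw [integrableOn_selfsimilarLevyMeasure_iff hα0 measurableSet_Ioc fun u hu => hu.1]
  rcases le_or_gt x 0 with hx | hx
  · simp [Ioc_eq_empty_of_le hx]
  have := ((intervalIntegral.intervalIntegrable_rpow' (a := 0) (b := x)
    (show -1 < (k - 1 - α : ℝ) by linarith)).const_mul α).1
  exact this.congr_fun (fun u hu => (pow_mul_selfsimilarDensity k hu.1).symm) measurableSet_Ioc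

lemma setIntegral_pow_selfsimilarLevyMeasure (hα0 : 0 ≤ α) (hα1 : α < 1) {k : ℕ} (hk : 1 ≤ k) :
    ∫ u in Ioc 0 1, u ^ k ∂(selfsimilarLevyMeasure α) = α / (k - α) := by
  have hk' : (1 : ℝ) ≤ k := by exact_mod_cast hk
  rw [setIntegral_selfsimilarLevyMeasure hα0 measurableSet_Ioc fun u hu => hu.1,
    setIntegral_congr_fun measurableSet_Ioc
      (fun u hu => pow_mul_selfsimilarDensity (α := α) k hu.1),
    ← intervalIntegral.integral_of_le zero_le_one, intervalIntegral.integral_const_mul,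
    integral_rpow (Or.inl (by linarith)), Real.one_rpow, Real.zero_rpow (by linarith)]
  rw [show (k - 1 - α + 1 : ℝ) = k - α by ring]
  ring

lemma integrableOn_one_sub_exp_selfsimilarLevyMeasure (hα0 : 0 ≤ α) (hα1 : α < 1) {w : ℝ}
    (hw : 0 ≤ w) (x : ℝ) :
    IntegrableOn (fun u => 1 - Real.exp (-w * u)) (Ioc 0 x) (selfsimilarLevyMeasure α) := by
  have h := (integrableOn_pow_selfsimilarLevyMeasure hα0 hα1 le_rfl x).const_mul w
  simp only [pow_one] at h
  refine h.mono (by fun_prop) ?_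
  filter_upwards [ae_restrict_mem measurableSet_Ioc] with u hu
  have h0 : 0 ≤ w * u := mul_nonneg hw hu.1.le
  have h1 : Real.exp (-w * u) ≤ 1 := Real.exp_le_one_iff.2 (by linarith)
  rw [Real.norm_of_nonneg (by linarith), Real.norm_of_nonneg h0]
  linarith [Real.add_one_le_exp (-w * u)]

lemma GFun_eq_setIntegral (hα0 : 0 ≤ α) (w : ℝ) :
    GFun α w = ∫ u in Ioc 0 1, 1 - Real.exp (-w * u) ∂(selfsimilarLevyMeasure α) := by
  rw [setIntegral_selfsimilarLevyMeasure hα0 measurableSet_Ioc fun u hu => hu.1,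
    ← intervalIntegral.integral_of_le zero_le_one, GFun, ← intervalIntegral.integral_const_mul]
  congr 1 with u
  ring

lemma GFun_nonneg (hα0 : 0 ≤ α) {w : ℝ} (hw : 0 ≤ w) : 0 ≤ GFun α w := by
  rw [GFun_eq_setIntegral hα0]
  refine setIntegral_nonneg measurableSet_Ioc fun u hu => sub_nonneg.2 ?_
  exact Real.exp_le_one_iff.2 (by nlinarith [hu.1])

lemma GFun_zero : GFun α 0 = 0 := by simp [GFun]

/-- The derivative of `GFun α`. -/
noncomputable def GFunDeriv (α w : ℝ) : ℝ :=
  ∫ u in Ioc 0 1, u * Real.exp (-w * u) ∂(selfsimilarLevyMeasure α)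

lemma integrableOn_mul_exp_selfsimilarLevyMeasure (hα0 : 0 ≤ α) (hα1 : α < 1) {w : ℝ}
    (hw : 0 ≤ w) :
    IntegrableOn (fun u => u * Real.exp (-w * u)) (Ioc 0 1) (selfsimilarLevyMeasure α) := by
  have h := integrableOn_pow_selfsimilarLevyMeasure hα0 hα1 le_rfl 1
  simp only [pow_one] at h
  refine Integrable.mono h (by fun_prop) ?_
  filter_upwards [ae_restrict_mem measurableSet_Ioc] with u hu
  rw [norm_mul, Real.norm_of_nonneg (Real.exp_pos _).le]
  exact mul_le_of_le_one_right (norm_nonneg _) (Real.exp_le_one_iff.2 (by nlinarith [hu.1]))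

lemma hasDerivAt_GFun (hα0 : 0 ≤ α) (hα1 : α < 1) {w : ℝ} (hw : 0 < w) :
    HasDerivAt (GFun α) (GFunDeriv α w) w := by
  have hb := integrableOn_pow_selfsimilarLevyMeasure hα0 hα1 le_rfl 1
  simp only [pow_one] at hb
  have h := (hasDerivAt_integral_of_dominated_loc_of_deriv_le
    (μ := (selfsimilarLevyMeasure α).restrict (Ioc 0 1))
    (F := fun w u => 1 - Real.exp (-w * u)) (F' := fun w u => u * Real.exp (-w * u))
    (bound := fun u => u) (Ioi_mem_nhds hw)
    (Eventually.of_forall fun v => by fun_prop)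
    (integrableOn_one_sub_exp_selfsimilarLevyMeasure hα0 hα1 hw.le 1)
    (by fun_prop) ?_ hb ?_).2
  · exact h.congr_of_eventuallyEq (Eventually.of_forall fun v => GFun_eq_setIntegral hα0 v)
  · filter_upwards [ae_restrict_mem measurableSet_Ioc] with u hu v hv
    rw [norm_mul, Real.norm_of_nonneg (Real.exp_pos _).le, Real.norm_of_nonneg hu.1.le]
    exact mul_le_of_le_one_right hu.1.le
      (Real.exp_le_one_iff.2 (by nlinarith [hu.1, mem_Ioi.1 hv]))
  · refine Eventually.of_forall fun u v _ => ?_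
    have h1 := (((hasDerivAt_neg v).mul_const u).exp).const_sub 1
    convert h1 using 1
    ring

/-- Integration by parts for `GFun`. -/
lemma mul_GFunDeriv (hα0 : 0 < α) (hα1 : α < 1) {w : ℝ} (hw : 0 ≤ w) :
    w * GFunDeriv α w = α * (GFun α w + 1 - Real.exp (-w)) := by
  have i1 := integrableOn_one_sub_exp_selfsimilarLevyMeasure hα0.le hα1 hw 1
  have i2 := (integrableOn_mul_exp_selfsimilarLevyMeasure hα0.le hα1 hw).const_mul (w / α)
  have e := integral_sub i1 i2
  rw [integral_const_mul, ← GFun_eq_setIntegral hα0.le, ← GFunDeriv] at e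
  have i3 := i1.sub i2
  rw [setIntegral_selfsimilarLevyMeasure hα0.le measurableSet_Ioc fun u hu => hu.1,
    ← intervalIntegral.integral_of_le zero_le_one] at e
  replace i3 := (integrableOn_selfsimilarLevyMeasure_iff hα0.le measurableSet_Ioc
    (fun u hu => hu.1) _).1 i3
  -- The antiderivative -(1 - exp(-w u)) u^{-α} is bounded by w u^{1-α}, hence continuous at 0 with
  -- value 0 because α < 1.
  have hF0 : ∀ u ∈ Icc (0 : ℝ) 1, |-(1 - Real.exp (-w * u)) * u ^ (-α)| ≤ w * u ^ (1 - α) := by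
    intro u hu
    rcases hu.1.eq_or_lt with rfl | hu0
    · simp [Real.zero_rpow (by linarith : 1 - α ≠ 0)]
    have h0 : 0 ≤ w * u := mul_nonneg hw hu.1
    have h1 : Real.exp (-w * u) ≤ 1 := Real.exp_le_one_iff.2 (by linarith)
    rw [abs_mul, abs_neg, abs_of_nonneg (by linarith), abs_of_pos (Real.rpow_pos_of_pos hu0 _),
      sub_eq_add_neg 1 α, Real.rpow_add hu0, Real.rpow_one, ← mul_assoc]
    exact mul_le_mul_of_nonneg_right (by linarith [Real.add_one_le_exp (-w * u)])
      (Real.rpow_nonneg hu.1 _)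
  have hFTC := intervalIntegral.integral_eq_sub_of_hasDerivAt_of_le
    (f := fun u => -(1 - Real.exp (-w * u)) * u ^ (-α)) zero_le_one ?_ (f' := fun u =>
      (1 - Real.exp (-w * u) - w / α * (u * Real.exp (-w * u))) * (α / u ^ (1 + α))) ?_ ?_
  · simp only [mul_one, Real.one_rpow, mul_zero, Real.exp_zero, sub_self, neg_zero, zero_mul,
      sub_zero] at hFTC
    rw [hFTC] at e
    have : w * GFunDeriv α w = α * (w / α * GFunDeriv α w) := by field_simp
    rw [this]
    linear_combination α * e
  · intro u hu
    rcases hu.1.eq_or_lt with rfl | hu0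
    · have hlim : Tendsto (fun u : ℝ => w * u ^ (1 - α)) (𝓝[Icc 0 1] 0) (𝓝 0) := by
        have : ContinuousAt (fun u : ℝ => w * u ^ (1 - α)) 0 :=
          (Real.continuousAt_rpow_const 0 _ (Or.inr (by linarith))).const_mul w
        have h2 := this.tendsto.mono_left (nhdsWithin_le_nhds (s := Icc (0 : ℝ) 1))
        simpa [Real.zero_rpow (by linarith : 1 - α ≠ 0)] using h2
      have := squeeze_zero_norm' (eventually_nhdsWithin_of_forall (s := Icc (0 : ℝ) 1)
        (a := 0) fun u hu => (Real.norm_eq_abs _).trans_le (hF0 u hu)) hlim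
      simpa [ContinuousWithinAt] using this
    · exact ((by fun_prop : Continuous fun u => -(1 - Real.exp (-w * u))).continuousAt.mul
        (Real.continuousAt_rpow_const u _ (Or.inl hu0.ne'))).continuousWithinAt
  · intro u hu
    have h1 := ((((hasDerivAt_id u).const_mul (-w)).exp.const_sub 1).neg).mul
      (Real.hasDerivAt_rpow_const (p := -α) (Or.inl hu.1.ne'))
    have e1 : u ^ (-α) = u * u ^ (-α - 1) := by
      rw [Real.rpow_sub hu.1, Real.rpow_one, mul_div_cancel₀ _ hu.1.ne']
    have e2 : α / u ^ (1 + α) = α * u ^ (-α - 1) := by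
      rw [show -α - 1 = -(1 + α) by ring, Real.rpow_neg hu.1.le, div_eq_mul_inv]
    refine h1.congr_deriv ?_
    simp only [id, Pi.neg_apply]
    rw [e1, e2]
    field_simp
    ring
  · rw [intervalIntegrable_iff_integrableOn_Ioc_of_le zero_le_one]
    exact i3

/-- The truncated Lévy characteristic of the selfsimilar Lévy measure. -/
lemma setIntegral_one_sub_indicator_exp (hα0 : 0 < α) (hα1 : α < 1) {x w : ℝ} (hx : 0 < x)
    (hw : 0 ≤ w) :
    ∫ y in Ioi 0, 1 - (Iio x).indicator (fun y => Real.exp (-w * y)) y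
      ∂(selfsimilarLevyMeasure α) = x ^ (-α) * (1 + GFun α (w * x)) := by
  have hne : ∀ᵐ y ∂(selfsimilarLevyMeasure α), y ≠ x := by
    simpa [ae_iff] using selfsimilarLevyMeasure_singleton (α := α) x
  have hIoc : ∀ᵐ y ∂(selfsimilarLevyMeasure α), y ∈ Ioc 0 x →
      1 - (Iio x).indicator (fun y => Real.exp (-w * y)) y = 1 - Real.exp (-w * y) := by
    filter_upwards [hne] with y hy hy'
    rw [indicator_of_mem (show y ∈ Iio x from lt_of_le_of_ne hy'.2 hy)]
  have hIoi : ∀ y ∈ Ioi x,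
      1 - (Iio x).indicator (fun y => Real.exp (-w * y)) y = 1 := fun y hy => by
    rw [indicator_of_notMem (by simpa using (mem_Ioi.1 hy).le), sub_zero]
  have hsub : Ioi x ⊆ Ioi 0 := Ioi_subset_Ioi hx.le
  have hdens : ∀ y ∈ Ioi x, (1 : ℝ) * (α / y ^ (1 + α)) = α * y ^ (-1 - α) := fun y hy => by
    have hy0 : 0 < y := hx.trans hy
    rw [show -1 - α = -(1 + α) by ring, Real.rpow_neg hy0.le, one_mul, div_eq_mul_inv]
  have hi1 : IntegrableOn (fun _ => (1 : ℝ)) (Ioi x) (selfsimilarLevyMeasure α) := by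
    rw [integrableOn_selfsimilarLevyMeasure_iff hα0.le measurableSet_Ioi hsub,
      integrableOn_congr_fun hdens measurableSet_Ioi]
    exact (integrableOn_Ioi_rpow_of_lt (by linarith) hx).const_mul α
  have hi2 := integrableOn_one_sub_exp_selfsimilarLevyMeasure hα0.le hα1 hw x
  -- Beyond x the integrand is 1 and contributes the tail x^{-α}; below x the substitution y = x u
  -- produces G(w x). The endpoint x is a null set.
  rw [← Ioc_union_Ioi_eq_Ioi hx.le, setIntegral_union (Ioc_disjoint_Ioi le_rfl) measurableSet_Ioi
    (hi2.congr_fun_ae (by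
      rw [EventuallyEq, ae_restrict_iff' measurableSet_Ioc]
      filter_upwards [hIoc] with y hy hy' using (hy hy').symm))
    (hi1.congr_fun (fun y hy => (hIoi y hy).symm) measurableSet_Ioi),
    setIntegral_congr_ae measurableSet_Ioc hIoc, setIntegral_congr_fun measurableSet_Ioi hIoi]
  have h1 : ∫ _ in Ioi x, (1 : ℝ) ∂(selfsimilarLevyMeasure α) = x ^ (-α) := by
    rw [setIntegral_selfsimilarLevyMeasure hα0.le measurableSet_Ioi hsub,
      setIntegral_congr_fun measurableSet_Ioi hdens, integral_const_mul,
      integral_Ioi_rpow_of_lt (by linarith) hx, show -1 - α + 1 = -α by ring]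
    field_simp
  have h2 : ∫ y in Ioc 0 x, 1 - Real.exp (-w * y) ∂(selfsimilarLevyMeasure α) =
      x ^ (-α) * GFun α (w * x) := by
    rw [GFun_eq_setIntegral hα0.le, setIntegral_selfsimilarLevyMeasure hα0.le measurableSet_Ioc
      (fun y hy => hy.1), setIntegral_selfsimilarLevyMeasure hα0.le measurableSet_Ioc
      (fun y hy => hy.1), ← intervalIntegral.integral_of_le hx.le,
      ← intervalIntegral.integral_of_le zero_le_one, ← intervalIntegral.integral_const_mul]
    have := intervalIntegral.mul_integral_comp_mul_left (a := 0) (b := 1) (c := x)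
      (f := fun y => (1 - Real.exp (-w * y)) * (α / y ^ (1 + α)))
    rw [mul_zero, mul_one] at this
    rw [← this, ← intervalIntegral.integral_const_mul]
    refine intervalIntegral.integral_congr fun u hu => ?_
    rw [uIcc_of_le zero_le_one] at hu
    have e1 : (x * u) ^ (1 + α) = x ^ (1 + α) * u ^ (1 + α) := Real.mul_rpow hx.le hu.1
    have e2 : x ^ (1 + α) = x * x ^ α := by rw [Real.rpow_add hx, Real.rpow_one]
    have e3 : x ^ α ≠ 0 := (Real.rpow_pos_of_pos hx α).ne'
    simp only [e1, e2, Real.rpow_neg hx.le]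
    rw [show -w * (x * u) = -(w * x) * u by ring]
    by_cases hu0 : u ^ (1 + α) = 0
    · simp [hu0]
    · field_simp
  rw [h1, h2]
  ring

end selfsimilarLevyMeasure

/-! ### From the truncated transform to the ratio. -/

section ratio

variable {Ω : Type*} [MeasurableSpace Ω] {P : Measure Ω}

lemma lintegral_mul_exp_neg_Ioc {b c : ℝ} (hb : 0 ≤ b) (hc : 0 ≤ c) :
    ∫⁻ r in Ioc 0 b, ENNReal.ofReal (c * Real.exp (-(r * c))) =
      ENNReal.ofReal (1 - Real.exp (-(b * c))) := by
  have hcont : Continuous fun r => c * Real.exp (-(r * c)) := by fun_prop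
  rw [← ofReal_integral_eq_lintegral_ofReal (hcont.integrableOn_Ioc)
    (Eventually.of_forall fun r => by positivity), ← intervalIntegral.integral_of_le hb,
    intervalIntegral.integral_eq_sub_of_hasDerivAt (f := fun r => -Real.exp (-(r * c)))
      (fun r _ => ?_) (hcont.intervalIntegrable _ _)]
  · congr 1
    simp only [zero_mul, neg_zero, Real.exp_zero]
    ring
  · refine (((hasDerivAt_id r).mul_const c).fun_neg.exp.fun_neg).congr_deriv ?_
    simp only [id]
    ring

/-- Here 1 - exp(-w Z/X) is the integral of w Z exp(-r w Z) over 0 < r ≤ 1/X; Tonelli replaces the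
quotient by the events X ≤ 1/r. -/
lemma lintegral_one_sub_exp_ratio [SFinite P] {Z X : Ω → ℝ} (hZm : Measurable Z)
    (hXm : Measurable X) (hZ : ∀ᵐ ω ∂P, 0 ≤ Z ω) (hX : ∀ᵐ ω ∂P, 0 < X ω) {w : ℝ} (hw : 0 ≤ w) :
    ∫⁻ ω, ENNReal.ofReal (1 - Real.exp (-w * (Z ω / X ω))) ∂P =
      ∫⁻ r in Ioi (0 : ℝ), ∫⁻ ω in {ω | r * X ω ≤ 1},
        ENNReal.ofReal (w * Z ω * Real.exp (-(r * (w * Z ω)))) ∂P := by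
  have hS : MeasurableSet {p : Ω × ℝ | p.2 * X p.1 ≤ 1} :=
    measurableSet_le (measurable_snd.mul (hXm.comp measurable_fst)) measurable_const
  have hg : Measurable fun p : Ω × ℝ =>
      ENNReal.ofReal (w * Z p.1 * Real.exp (-(p.2 * (w * Z p.1)))) := by fun_prop
  have hswap := lintegral_lintegral_swap (μ := P) (ν := volume.restrict (Ioi (0 : ℝ)))
    (f := fun ω r => {p : Ω × ℝ | p.2 * X p.1 ≤ 1}.indicator (fun p : Ω × ℝ =>
      ENNReal.ofReal (w * Z p.1 * Real.exp (-(p.2 * (w * Z p.1))))) (ω, r))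
    (hg.indicator hS).aemeasurable
  convert hswap using 1
  · refine lintegral_congr_ae ?_
    filter_upwards [hZ, hX] with ω hZω hXω
    have h1 : ∀ r : ℝ, {p : Ω × ℝ | p.2 * X p.1 ≤ 1}.indicator (fun p : Ω × ℝ =>
        ENNReal.ofReal (w * Z p.1 * Real.exp (-(p.2 * (w * Z p.1))))) (ω, r) =
        (Iic (X ω)⁻¹).indicator
          (fun r => ENNReal.ofReal (w * Z ω * Real.exp (-(r * (w * Z ω))))) r := by
      intro r
      have : r * X ω ≤ 1 ↔ r ≤ (X ω)⁻¹ := by rw [← one_div, le_div_iff₀ hXω]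
      simp only [indicator, mem_ofPred_eq, mem_Iic, this]
    simp only [h1]
    rw [lintegral_indicator measurableSet_Iic, Measure.restrict_restrict measurableSet_Iic,
      inter_comm, Ioi_inter_Iic, lintegral_mul_exp_neg_Ioc (by positivity) (by positivity)]
    congr 3
    field_simp
  · refine lintegral_congr fun r => ?_
    rw [← lintegral_indicator (measurableSet_le (hXm.const_mul r) measurable_const)]
    rfl

end ratio

section selfsimilar

variable {Ω : Type*} [MeasurableSpace Ω] {L : ℝ≥0 → Ω → ℝ} {P : Measure Ω}
  {α : ℝ} {t : ℝ≥0}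

lemma IsSelfsimilarSubordinator.aemeasurable_restRatio
    (hL : IsSelfsimilarSubordinator α L P) (t : ℝ≥0) : AEMeasurable (restRatio L t) P :=
  ((hL.measurable t).aemeasurable.sub (hL.aemeasurable_greatestFlight t)).div
    (hL.aemeasurable_greatestFlight t)

lemma IsSelfsimilarSubordinator.ae_restRatio_nonneg
    (hL : IsSelfsimilarSubordinator α L P) (t : ℝ≥0) : ∀ᵐ ω ∂P, 0 ≤ restRatio L t ω := by
  filter_upwards [hL.ae_monotone, hL.zero] with ω hm h0
  have := greatestFlight_le_sub (t := t) hm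
  rw [h0, sub_zero] at this
  exact div_nonneg (sub_nonneg.2 this) greatestFlight_nonneg

variable [IsProbabilityMeasure P]

lemma IsSelfsimilarSubordinator.integral_exp_greatestFlight_le (hα0 : 0 < α) (hα1 : α < 1)
    (hL : IsSelfsimilarSubordinator α L P) (ht : 0 < t) {x w : ℝ} (hx : 0 < x) (hw : 0 ≤ w) :
    ∫ ω in {ω | greatestFlight L t ω ≤ x}, Real.exp (-w * L t ω) ∂P =
      Real.exp (-t * (x ^ (-α) * (1 + GFun α (w * x)))) := by
  rw [_root_.integral_exp_greatestFlight_le hL.toIsOneSidedLevyProcess hL.hasLevyMeasure ht hx hw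
    (selfsimilarLevyMeasure_singleton x), setIntegral_one_sub_indicator_exp hα0 hα1 hx hw]

/-- At w = 0 the truncated transform is the distribution function P(X ≤ 1/r) = exp(-t r^α), which
tends to 0 as r grows. -/
lemma IsSelfsimilarSubordinator.ae_greatestFlight_pos (hα0 : 0 < α) (hα1 : α < 1)
    (hL : IsSelfsimilarSubordinator α L P) (ht : 0 < t) :
    ∀ᵐ ω ∂P, 0 < greatestFlight L t ω := by
  have h1 : ∀ r : ℝ, 0 < r →
      P.real {ω | greatestFlight L t ω ≤ 0} ≤ Real.exp (-(t * r ^ α)) := by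
    intro r hr
    have h2 := hL.integral_exp_greatestFlight_le hα0 hα1 ht (inv_pos.2 hr) le_rfl
    simp only [neg_zero, zero_mul, Real.exp_zero, GFun_zero, add_zero, mul_one,
      Real.inv_rpow hr.le, Real.rpow_neg hr.le, inv_inv, integral_const, smul_eq_mul,
      measureReal_restrict_apply_univ] at h2
    rw [← neg_mul, ← h2]
    exact measureReal_mono fun ω hω => le_trans hω (inv_pos.2 hr).le
  have ht' : (0 : ℝ) < t := ht
  have h2 : Tendsto (fun r : ℝ => Real.exp (-(t * r ^ α))) atTop (𝓝 0) :=
    Real.tendsto_exp_neg_atTop_nhds_zero.comp ((tendsto_rpow_atTop hα0).const_mul_atTop ht')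
  have h3 : P.real {ω | greatestFlight L t ω ≤ 0} ≤ 0 := ge_of_tendsto h2 (by
    filter_upwards [eventually_gt_atTop 0] with r hr using h1 r hr)
  have h4 : P {ω | greatestFlight L t ω ≤ 0} = 0 :=
    (measureReal_eq_zero_iff).1 (le_antisymm h3 measureReal_nonneg)
  simpa [ae_iff] using h4

/-- The truncated transform is differentiated in the frequency: one side is a moment generating
function under the restricted measure, the other is explicit. -/
lemma IsSelfsimilarSubordinator.integral_mul_exp_greatestFlight_le (hα0 : 0 < α) (hα1 : α < 1)
    (hL : IsSelfsimilarSubordinator α L P) (ht : 0 < t) {x v : ℝ} (hx : 0 < x) (hv : 0 < v) :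
    IntegrableOn (fun ω => L t ω * Real.exp (-v * L t ω)) {ω | greatestFlight L t ω ≤ x} P ∧
    ∫ ω in {ω | greatestFlight L t ω ≤ x}, L t ω * Real.exp (-v * L t ω) ∂P =
      t * (x ^ (-α) * (x * GFunDeriv α (v * x))) *
        Real.exp (-t * (x ^ (-α) * (1 + GFun α (v * x)))) := by
  set μ := P.restrict {ω | greatestFlight L t ω ≤ x} with hμ
  have hset : Iic 0 ⊆ integrableExpSet (L t) μ := by
    intro s hs
    refine Integrable.of_bound ((hL.measurable t).const_mul s).exp.aestronglyMeasurable 1 ?_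
    filter_upwards [ae_restrict_of_ae (hL.ae_nonneg t)] with ω hω
    rw [Real.norm_of_nonneg (Real.exp_pos _).le]
    exact Real.exp_le_one_iff.2 (mul_nonpos_of_nonpos_of_nonneg hs hω)
  have hmem : -v ∈ interior (integrableExpSet (L t) μ) :=
    mem_interior.2 ⟨Iio 0, Iio_subset_Iic_self.trans hset, isOpen_Iio, by simpa using hv⟩
  refine ⟨?_, ?_⟩
  · simpa [IntegrableOn] using integrable_pow_mul_exp_of_mem_interior_integrableExpSet hmem 1
  have h1 : HasDerivAt (fun s => mgf (L t) μ (-s))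
      (-∫ ω, L t ω * Real.exp (-v * L t ω) ∂μ) v := by
    have := (hasDerivAt_mgf hmem).comp v (hasDerivAt_neg v)
    rw [mul_neg_one] at this
    exact this
  have h2 : HasDerivAt (fun s => Real.exp (-t * (x ^ (-α) * (1 + GFun α (s * x)))))
      (Real.exp (-t * (x ^ (-α) * (1 + GFun α (v * x)))) *
        (-t * (x ^ (-α) * (GFunDeriv α (v * x) * x)))) v := by
    have h3 : HasDerivAt (fun s : ℝ => s * x) x v := by
      simpa using (hasDerivAt_id v).mul_const x
    have h4 : HasDerivAt (fun s => GFun α (s * x)) (GFunDeriv α (v * x) * x) v :=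
      HasDerivAt.comp (h₂ := GFun α) v (hasDerivAt_GFun hα0.le hα1 (mul_pos hv hx)) h3
    exact (((h4.const_add 1).const_mul _).const_mul _).exp
  have h3 := h1.congr_of_eventuallyEq (f₁ := fun s =>
      Real.exp (-t * (x ^ (-α) * (1 + GFun α (s * x))))) (by
    filter_upwards [Ioi_mem_nhds hv] with s hs
    rw [mgf, ← hL.integral_exp_greatestFlight_le hα0 hα1 ht hx (mem_Ioi.1 hs).le])
  linear_combination -(h3.unique h2)

lemma lintegral_rpow_mul_exp_neg_rpow {c A : ℝ} (hα : 0 < α) (hc : 0 < c) (hA : 0 < A) {B : ℝ}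
    (hB : 0 ≤ B) :
    ∫⁻ r in Ioi (0 : ℝ), ENNReal.ofReal (B * (c * r ^ (α - 1) * Real.exp (-(c * r ^ α * A)))) =
      ENNReal.ofReal (B / (α * A)) := by
  set g : ℝ → ℝ := fun r => -(B / (α * A)) * Real.exp (-(c * r ^ α * A)) with hg
  have hcont : ContinuousWithinAt g (Ici 0) 0 := by
    have : ContinuousAt (fun r : ℝ => r ^ α) 0 :=
      Real.continuousAt_rpow_const 0 _ (Or.inr hα.le)
    exact ((((this.const_mul c).mul_const A).neg.rexp).const_mul _).continuousWithinAt
  have hderiv : ∀ r ∈ Ioi (0 : ℝ),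
      HasDerivAt g (B * (c * r ^ (α - 1) * Real.exp (-(c * r ^ α * A)))) r := by
    intro r hr
    have := ((((Real.hasDerivAt_rpow_const (p := α) (Or.inl (mem_Ioi.1 hr).ne')).const_mul
      c).mul_const A).fun_neg.exp).const_mul (-(B / (α * A)))
    refine this.congr_deriv ?_
    field_simp
  have hpos : ∀ r ∈ Ioi (0 : ℝ), 0 ≤ B * (c * r ^ (α - 1) * Real.exp (-(c * r ^ α * A))) := by
    intro r hr
    have := Real.rpow_nonneg (mem_Ioi.1 hr).le (α - 1)
    positivity
  have hlim : Tendsto g atTop (𝓝 0) := by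
    have h1 := Real.tendsto_exp_neg_atTop_nhds_zero.comp
      (((tendsto_rpow_atTop hα).const_mul_atTop hc).atTop_mul_const hA)
    simpa [hg] using h1.const_mul (-(B / (α * A)))
  have hint := integrableOn_Ioi_deriv_of_nonneg hcont hderiv hpos hlim
  rw [← ofReal_integral_eq_lintegral_ofReal hint ((ae_restrict_iff' measurableSet_Ioi).2
    (Eventually.of_forall hpos)), integral_Ioi_of_hasDerivAt_of_nonneg hcont hderiv hpos hlim]
  simp [hg, Real.zero_rpow hα.ne']

/-- With level 1/r and frequency w r the argument of G is constantly w, so the r-integrand is a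
constant times t r^{α-1} exp(-t r^α (1 + G(w))), which integrates exactly and loses t. -/
lemma IsSelfsimilarSubordinator.integral_one_sub_exp_div (hα0 : 0 < α) (hα1 : α < 1)
    (hL : IsSelfsimilarSubordinator α L P) (ht : 0 < t) {w : ℝ} (hw : 0 < w) :
    ∫ ω, 1 - Real.exp (-w * (L t ω / greatestFlight L t ω)) ∂P =
      w * GFunDeriv α w / (α * (1 + GFun α w)) := by
  have ht' : (0 : ℝ) < t := ht
  have hXm := hL.aemeasurable_greatestFlight t
  have hXpos := hL.ae_greatestFlight_pos hα0 hα1 ht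
  have hG : 0 < 1 + GFun α w := by linarith [GFun_nonneg hα0.le hw.le]
  have hG' : 0 ≤ w * GFunDeriv α w := mul_nonneg hw.le
    (setIntegral_nonneg measurableSet_Ioc fun u hu => mul_nonneg hu.1.le (Real.exp_pos _).le)
  rw [integral_eq_lintegral_of_nonneg_ae]
  rotate_left
  · filter_upwards [hL.ae_nonneg t, hXpos] with ω h1 h2
    have : 0 ≤ w * (L t ω / greatestFlight L t ω) := by positivity
    exact sub_nonneg.2 (Real.exp_le_one_iff.2 (by linarith))
  · exact ((((hL.measurable t).aemeasurable.div hXm).const_mul (-w)).exp.const_sub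
      1).aestronglyMeasurable
  -- X is only almost everywhere measurable; a measurable version is substituted for the use of
  -- Tonelli.
  have hmk := hXm.ae_eq_mk
  have e1 : ∫⁻ ω, ENNReal.ofReal (1 - Real.exp (-w * (L t ω / greatestFlight L t ω))) ∂P =
      ∫⁻ ω, ENNReal.ofReal (1 - Real.exp (-w * (L t ω / hXm.mk _ ω))) ∂P := by
    refine lintegral_congr_ae ?_
    filter_upwards [hmk] with ω hω
    rw [hω]
  rw [e1, lintegral_one_sub_exp_ratio (hL.measurable t) hXm.measurable_mk (hL.ae_nonneg t) (by
    filter_upwards [hmk, hXpos] with ω h1 h2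
    rwa [← h1]) hw.le]
  have e2 : ∀ r ∈ Ioi (0 : ℝ), ∫⁻ ω in {ω | r * hXm.mk _ ω ≤ 1},
      ENNReal.ofReal (w * L t ω * Real.exp (-(r * (w * L t ω)))) ∂P =
      ENNReal.ofReal (w * GFunDeriv α w *
        (t * r ^ (α - 1) * Real.exp (-(t * r ^ α * (1 + GFun α w))))) := by
    intro r hr
    have hr0 : 0 < r := hr
    have hset : {ω | r * hXm.mk _ ω ≤ 1} =ᵐ[P] {ω | greatestFlight L t ω ≤ r⁻¹} := by
      refine eventuallyEq_set.2 ?_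
      filter_upwards [hmk] with ω hω
      have : r * greatestFlight L t ω ≤ 1 ↔ greatestFlight L t ω ≤ r⁻¹ := by
        rw [← one_div, le_div_iff₀' hr0]
      simpa [← hω] using this
    obtain ⟨hi, he⟩ := hL.integral_mul_exp_greatestFlight_le hα0 hα1 ht (inv_pos.2 hr0)
      (mul_pos hw hr0)
    have hfun : ∀ ω, w * L t ω * Real.exp (-(r * (w * L t ω))) =
        w * (L t ω * Real.exp (-(w * r) * L t ω)) := fun ω => by ring_nf
    simp only [hfun]
    rw [setLIntegral_congr hset, ← ofReal_integral_eq_lintegral_ofReal (hi.const_mul w) (by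
      filter_upwards [ae_restrict_of_ae (hL.ae_nonneg t)] with ω hω
      positivity), integral_const_mul, he, Real.inv_rpow hr0.le, Real.rpow_neg hr0.le, inv_inv,
      mul_inv_cancel_right₀ hr0.ne', Real.rpow_sub hr0, Real.rpow_one]
    congr 1
    ring_nf
  rw [setLIntegral_congr_fun measurableSet_Ioi e2,
    lintegral_rpow_mul_exp_neg_rpow hα0 ht' hG hG', ENNReal.toReal_ofReal (by positivity)]

theorem IsSelfsimilarSubordinator.integral_exp_restRatio (hα0 : 0 < α) (hα1 : α < 1)
    (hL : IsSelfsimilarSubordinator α L P) (ht : 0 < t) {w : ℝ} (hw : 0 ≤ w) :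
    ∫ ω, Real.exp (-w * restRatio L t ω) ∂P = 1 / (1 + GFun α w) := by
  rcases hw.eq_or_lt with rfl | hw
  · simp [GFun_zero]
  have hXpos := hL.ae_greatestFlight_pos hα0 hα1 ht
  have hG : 0 < 1 + GFun α w := by linarith [GFun_nonneg hα0.le hw.le]
  have hi : Integrable (fun ω => Real.exp (-w * (L t ω / greatestFlight L t ω))) P := by
    refine Integrable.of_bound (((hL.measurable t).aemeasurable.div
      (hL.aemeasurable_greatestFlight t)).const_mul (-w)).exp.aestronglyMeasurable 1 ?_
    filter_upwards [hL.ae_nonneg t, hXpos] with ω h1 h2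
    have : 0 ≤ w * (L t ω / greatestFlight L t ω) := by positivity
    rw [Real.norm_of_nonneg (Real.exp_pos _).le]
    exact Real.exp_le_one_iff.2 (by linarith)
  have h1 := hL.integral_one_sub_exp_div hα0 hα1 ht hw
  rw [integral_sub (integrable_const 1) hi, mul_GFunDeriv hα0 hα1 hw.le] at h1
  simp only [integral_const, probReal_univ, smul_eq_mul, mul_one] at h1
  have h2 : ∫ ω, Real.exp (-w * restRatio L t ω) ∂P =
      Real.exp w * ∫ ω, Real.exp (-w * (L t ω / greatestFlight L t ω)) ∂P := by
    rw [← integral_const_mul]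
    refine integral_congr_ae ?_
    filter_upwards [hXpos] with ω hω
    rw [← Real.exp_add, restRatio]
    congr 1
    field_simp
    ring
  have h3 : ∫ ω, Real.exp (-w * (L t ω / greatestFlight L t ω)) ∂P =
      Real.exp (-w) / (1 + GFun α w) := by
    have h4 := sub_eq_iff_eq_add'.1 h1
    rw [eq_sub_of_add_eq h4.symm]
    field_simp
    ring
  rw [h2, h3, ← mul_div_assoc, ← Real.exp_add, add_neg_cancel, Real.exp_zero]

end selfsimilar

/-! ### Moments and laws from Laplace transforms. -/

section moments

variable {S : Type*} [MeasurableSpace S] {μ : Measure S} {Z : S → ℝ}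

lemma one_sub_exp_div_nonneg {z w : ℝ} (hz : 0 ≤ z) (hw : 0 < w) :
    0 ≤ (1 - Real.exp (-w * z)) / w :=
  div_nonneg (sub_nonneg.2 (Real.exp_le_one_iff.2 (by nlinarith))) hw.le

lemma one_sub_exp_div_le {z w : ℝ} (hw : 0 < w) : (1 - Real.exp (-w * z)) / w ≤ z := by
  rw [div_le_iff₀ hw]
  linarith [Real.add_one_le_exp (-w * z)]

lemma tendsto_one_sub_exp_div (z : ℝ) :
    Tendsto (fun w : ℝ => (1 - Real.exp (-w * z)) / w) (𝓝[>] 0) (𝓝 z) := by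
  have h1 : HasDerivAt (fun w : ℝ => -Real.exp (-w * z)) z 0 := by
    refine (((hasDerivAt_neg 0).mul_const z).exp.fun_neg).congr_deriv ?_
    simp
  have h2 := (hasDerivAt_iff_tendsto_slope_zero.1 h1).mono_left
    (nhdsWithin_mono 0 fun w (hw : 0 < w) => hw.ne')
  refine h2.congr fun w => ?_
  simp only [zero_add, neg_zero, zero_mul, Real.exp_zero, smul_eq_mul]
  ring

lemma tendsto_integral_one_sub_exp_div_pow (hZ : ∀ᵐ x ∂μ, 0 ≤ Z x) (hZm : AEMeasurable Z μ)
    {k : ℕ} (hi : Integrable (fun x => Z x ^ k) μ) :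
    Tendsto (fun w : ℝ => ∫ x, ((1 - Real.exp (-w * Z x)) / w) ^ k ∂μ) (𝓝[>] 0)
      (𝓝 (∫ x, Z x ^ k ∂μ)) := by
  refine tendsto_integral_filter_of_dominated_convergence _ ?_ ?_ hi ?_
  · exact Eventually.of_forall fun w =>
      ((((hZm.const_mul (-w)).exp.const_sub 1).div_const w).pow_const k).aestronglyMeasurable
  · filter_upwards [self_mem_nhdsWithin] with w hw
    filter_upwards [hZ] with x hx
    have h0 := one_sub_exp_div_nonneg hx hw
    rw [Real.norm_of_nonneg (pow_nonneg h0 k)]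
    exact pow_le_pow_left₀ h0 (one_sub_exp_div_le hw) k
  · exact Eventually.of_forall fun x => (tendsto_one_sub_exp_div (Z x)).pow k

/-- Fatou along w = 1/(n+1): the truncated quantities are bounded, converge pointwise to the power
of Z, and have convergent integrals. -/
lemma integrable_pow_of_tendsto [IsFiniteMeasure μ] (hZ : ∀ᵐ x ∂μ, 0 ≤ Z x)
    (hZm : AEMeasurable Z μ) {k : ℕ} {ℓ : ℝ}
    (h : Tendsto (fun w : ℝ => ∫ x, ((1 - Real.exp (-w * Z x)) / w) ^ k ∂μ) (𝓝[>] 0) (𝓝 ℓ)) :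
    Integrable (fun x => Z x ^ k) μ := by
  have hZk : 0 ≤ᵐ[μ] fun x => Z x ^ k := by
    filter_upwards [hZ] with x hx using pow_nonneg hx k
  have hm : ∀ w : ℝ, AEMeasurable (fun x => ((1 - Real.exp (-w * Z x)) / w) ^ k) μ := fun w =>
    (((hZm.const_mul (-w)).exp.const_sub 1).div_const w).pow_const k
  set u : ℕ → ℝ := fun n => 1 / ((n : ℝ) + 1) with hu
  have hu0 : ∀ n, 0 < u n := fun n => by positivity
  have hut : Tendsto u atTop (𝓝[>] 0) := tendsto_nhdsWithin_iff.2
    ⟨tendsto_one_div_add_atTop_nhds_zero_nat, Eventually.of_forall hu0⟩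
  refine ⟨(hZm.pow_const k).aestronglyMeasurable, ?_⟩
  rw [hasFiniteIntegral_iff_ofReal hZk]
  have hint : ∀ n, Integrable (fun x => ((1 - Real.exp (-u n * Z x)) / u n) ^ k) μ := by
    intro n
    refine Integrable.of_bound (hm _).aestronglyMeasurable ((1 / u n) ^ k) ?_
    filter_upwards [hZ] with x hx
    have h0 := one_sub_exp_div_nonneg hx (hu0 n)
    rw [Real.norm_of_nonneg (pow_nonneg h0 k)]
    exact pow_le_pow_left₀ h0 (div_le_div_of_nonneg_right
      (by linarith [Real.exp_pos (-u n * Z x)]) (hu0 n).le) k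
  have e1 : ∫⁻ x, ENNReal.ofReal (Z x ^ k) ∂μ = ∫⁻ x, liminf (fun n =>
      ENNReal.ofReal (((1 - Real.exp (-u n * Z x)) / u n) ^ k)) atTop ∂μ := by
    refine lintegral_congr fun x => (Tendsto.liminf_eq ?_).symm
    exact ENNReal.tendsto_ofReal (((tendsto_one_sub_exp_div (Z x)).comp hut).pow k)
  have e2 : ∀ n, ∫⁻ x, ENNReal.ofReal (((1 - Real.exp (-u n * Z x)) / u n) ^ k) ∂μ =
      ENNReal.ofReal (∫ x, ((1 - Real.exp (-u n * Z x)) / u n) ^ k ∂μ) := fun n =>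
    (ofReal_integral_eq_lintegral_ofReal (hint n) (by
      filter_upwards [hZ] with x hx
      exact pow_nonneg (one_sub_exp_div_nonneg hx (hu0 n)) k)).symm
  rw [e1]
  refine (lintegral_liminf_le' fun n => (hm _).ennreal_ofReal).trans_lt ?_
  simp only [e2]
  exact (ENNReal.tendsto_ofReal (h.comp hut)).liminf_eq.trans_lt ENNReal.ofReal_lt_top

/-- The moment of order `k` of a nonnegative random variable, read off its Laplace transform. -/
lemma integrable_pow_and_integral_eq_of_tendsto [IsFiniteMeasure μ] (hZ : ∀ᵐ x ∂μ, 0 ≤ Z x)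
    (hZm : AEMeasurable Z μ) {k : ℕ} {ℓ : ℝ}
    (h : Tendsto (fun w : ℝ => ∫ x, ((1 - Real.exp (-w * Z x)) / w) ^ k ∂μ) (𝓝[>] 0) (𝓝 ℓ)) :
    Integrable (fun x => Z x ^ k) μ ∧ ∫ x, Z x ^ k ∂μ = ℓ := by
  have hi := integrable_pow_of_tendsto hZ hZm h
  exact ⟨hi, tendsto_nhds_unique (tendsto_integral_one_sub_exp_div_pow hZ hZm hi) h⟩

/-- The Laplace transform at the natural numbers determines the law of a nonnegative variable. -/
lemma identDistrib_of_laplace_eq [IsFiniteMeasure μ] {Y : S → ℝ} (hZ : ∀ᵐ x ∂μ, 0 ≤ Z x)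
    (hZm : AEMeasurable Z μ) (hY : ∀ᵐ x ∂μ, 0 ≤ Y x) (hYm : AEMeasurable Y μ)
    (h : ∀ k : ℕ, ∫ x, Real.exp (-k * Z x) ∂μ = ∫ x, Real.exp (-k * Y x) ∂μ) :
    IdentDistrib Z Y μ μ := by
  have hm : ∀ {X : S → ℝ}, AEMeasurable X μ → AEMeasurable (fun x => Real.exp (-X x)) μ :=
    fun hX => hX.neg.exp
  have hmem : ∀ {X : S → ℝ}, AEMeasurable X μ → (∀ᵐ x ∂μ, 0 ≤ X x) →
      ∀ᵐ u ∂(μ.map fun x => Real.exp (-X x)), u ∈ Icc (0 : ℝ) 1 := by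
    intro X hX hX0
    refine (ae_map_iff (hm hX) measurableSet_Icc).2 ?_
    filter_upwards [hX0] with x hx
    exact ⟨(Real.exp_pos _).le, Real.exp_le_one_iff.2 (by linarith)⟩
  have hpow : ∀ {X : S → ℝ}, AEMeasurable X μ → ∀ k : ℕ,
      ∫ u, u ^ k ∂(μ.map fun x => Real.exp (-X x)) = ∫ x, Real.exp (-k * X x) ∂μ := by
    intro X hX k
    rw [integral_map (hm hX) (continuous_pow k).aestronglyMeasurable]
    congr 1 with x
    rw [← Real.exp_nat_mul]
    ring_nf
  have hmap : IdentDistrib (fun x => Real.exp (-Z x)) (fun x => Real.exp (-Y x)) μ μ :=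
    ⟨hm hZm, hm hYm, ext_of_moments (hmem hZm hZ) (hmem hYm hY) fun k => by
      rw [hpow hZm, hpow hYm, h]⟩
  have := hmap.comp (u := fun u => -Real.log u) Real.measurable_log.neg
  simpa [Function.comp_def] using this

end moments

/-! ### Behaviour of G at zero. -/

section GFunAsymptotics

variable {α : ℝ}

/-- The moment limit also holds for infinite measures, so it applies to the Lévy measure on (0, 1],
whose first moment is α / (1 - α). -/
lemma tendsto_GFun_div (hα0 : 0 < α) (hα1 : α < 1) :
    Tendsto (fun w => GFun α w / w) (𝓝[>] 0) (𝓝 (α / (1 - α))) := by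
  have h := tendsto_integral_one_sub_exp_div_pow
    (μ := (selfsimilarLevyMeasure α).restrict (Ioc 0 1)) (Z := fun u => u) (k := 1)
    ((ae_restrict_mem measurableSet_Ioc).mono fun u hu => hu.1.le) aemeasurable_id'
    (integrableOn_pow_selfsimilarLevyMeasure hα0.le hα1 le_rfl 1)
  rw [setIntegral_pow_selfsimilarLevyMeasure hα0.le hα1 le_rfl, Nat.cast_one] at h
  refine h.congr fun w => ?_
  simp only [pow_one]
  rw [integral_div, GFun_eq_setIntegral hα0.le]

/-- The numerator is the integral of (1 - exp(-w u))², so the limit is the second moment of the Lévy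
measure on (0, 1]. -/
lemma tendsto_two_mul_GFun_sub_div (hα0 : 0 < α) (hα1 : α < 1) :
    Tendsto (fun w => (2 * GFun α w - GFun α (2 * w)) / w ^ 2) (𝓝[>] 0) (𝓝 (α / (2 - α))) := by
  have h := tendsto_integral_one_sub_exp_div_pow
    (μ := (selfsimilarLevyMeasure α).restrict (Ioc 0 1)) (Z := fun u => u) (k := 2)
    ((ae_restrict_mem measurableSet_Ioc).mono fun u hu => hu.1.le) aemeasurable_id'
    (integrableOn_pow_selfsimilarLevyMeasure hα0.le hα1 one_le_two 1)
  rw [setIntegral_pow_selfsimilarLevyMeasure hα0.le hα1 one_le_two, Nat.cast_ofNat] at h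
  refine h.congr' ?_
  filter_upwards [self_mem_nhdsWithin] with w hw
  have hw0 : 0 ≤ w := (mem_Ioi.1 hw).le
  rw [GFun_eq_setIntegral hα0.le, GFun_eq_setIntegral hα0.le, ← integral_const_mul,
    ← integral_sub ((integrableOn_one_sub_exp_selfsimilarLevyMeasure hα0.le hα1 hw0 1).const_mul 2)
      (integrableOn_one_sub_exp_selfsimilarLevyMeasure hα0.le hα1 (by positivity) 1),
    ← integral_div]
  congr 1 with u
  have : Real.exp (-(2 * w) * u) = Real.exp (-w * u) ^ 2 := by
    rw [← Real.exp_nat_mul]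
    push_cast
    ring_nf
  rw [this]
  ring

lemma tendsto_GFun_zero (hα0 : 0 < α) (hα1 : α < 1) : Tendsto (GFun α) (𝓝[>] 0) (𝓝 0) := by
  have h1 : Tendsto (fun w : ℝ => w) (𝓝[>] 0) (𝓝 0) := nhdsWithin_le_nhds
  have h2 := h1.mul (tendsto_GFun_div hα0 hα1)
  rw [zero_mul] at h2
  refine h2.congr' ?_
  filter_upwards [self_mem_nhdsWithin] with w hw
  exact mul_div_cancel₀ _ (mem_Ioi.1 hw).ne'

lemma tendsto_two_mul_nhdsGT_zero : Tendsto (fun w : ℝ => 2 * w) (𝓝[>] 0) (𝓝[>] 0) := by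
  refine tendsto_nhdsWithin_iff.2 ⟨?_, ?_⟩
  · have : Tendsto (fun w : ℝ => 2 * w) (𝓝 0) (𝓝 (2 * 0)) := tendsto_id.const_mul 2
    rw [mul_zero] at this
    exact this.mono_left nhdsWithin_le_nhds
  · filter_upwards [self_mem_nhdsWithin] with w hw
    exact mul_pos two_pos (mem_Ioi.1 hw)

end GFunAsymptotics

/-! ### Mean and variance of the ratio. -/

section restRatio

variable {Ω : Type*} [MeasurableSpace Ω] {L : ℝ≥0 → Ω → ℝ} {P : Measure Ω}
  [IsProbabilityMeasure P] {α : ℝ} {t : ℝ≥0}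

lemma IsSelfsimilarSubordinator.integrable_exp_restRatio
    (hL : IsSelfsimilarSubordinator α L P) (t : ℝ≥0) {w : ℝ} (hw : 0 ≤ w) :
    Integrable (fun ω => Real.exp (-w * restRatio L t ω)) P := by
  refine Integrable.of_bound
    ((hL.aemeasurable_restRatio t).const_mul (-w)).exp.aestronglyMeasurable 1 ?_
  filter_upwards [hL.ae_restRatio_nonneg t] with ω h
  rw [Real.norm_of_nonneg (Real.exp_pos _).le]
  exact Real.exp_le_one_iff.2 (by nlinarith)

lemma IsSelfsimilarSubordinator.integral_restRatio (hα0 : 0 < α) (hα1 : α < 1)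
    (hL : IsSelfsimilarSubordinator α L P) (ht : 0 < t) :
    ∫ ω, restRatio L t ω ∂P = α / (1 - α) := by
  have hlim : Tendsto (fun w : ℝ => ∫ ω, ((1 - Real.exp (-w * restRatio L t ω)) / w) ^ 1 ∂P)
      (𝓝[>] 0) (𝓝 (α / (1 - α))) := by
    have h := (tendsto_GFun_div hα0 hα1).div ((tendsto_GFun_zero hα0 hα1).const_add 1)
      (by norm_num)
    rw [add_zero, div_one] at h
    refine h.congr' ?_
    filter_upwards [self_mem_nhdsWithin] with w hw
    have hw0 : 0 < w := hw
    have hG := GFun_nonneg hα0.le hw0.le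
    simp only [pow_one, Pi.div_apply]
    rw [integral_div, integral_sub (integrable_const 1) (hL.integrable_exp_restRatio t hw0.le),
      hL.integral_exp_restRatio hα0 hα1 ht hw0.le]
    simp only [integral_const, probReal_univ, smul_eq_mul, mul_one]
    field_simp
    ring
  have := (integrable_pow_and_integral_eq_of_tendsto (hL.ae_restRatio_nonneg t)
    (hL.aemeasurable_restRatio t) hlim).2
  simpa only [pow_one] using this

lemma IsSelfsimilarSubordinator.integral_restRatio_sq (hα0 : 0 < α) (hα1 : α < 1)
    (hL : IsSelfsimilarSubordinator α L P) (ht : 0 < t) :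
    Integrable (fun ω => restRatio L t ω ^ 2) P ∧
      ∫ ω, restRatio L t ω ^ 2 ∂P = α / (2 - α) + 2 * (α / (1 - α)) ^ 2 := by
  refine integrable_pow_and_integral_eq_of_tendsto (hL.ae_restRatio_nonneg t)
    (hL.aemeasurable_restRatio t) ?_
  have h0 := tendsto_GFun_zero hα0 hα1
  have h1 := tendsto_GFun_div hα0 hα1
  -- E(1 - exp(-w ξ))² equals (2 G(w) - G(2w) + G(w) G(2w)) / ((1 + G(w)) (1 + G(2w))). After
  -- division by w² the product term is 2 (G(w)/w) (G(2w)/(2w)), whence the factor 2.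
  have h := ((tendsto_two_mul_GFun_sub_div hα0 hα1).add
    ((h1.mul (h1.comp tendsto_two_mul_nhdsGT_zero)).const_mul 2)).div
    ((h0.const_add 1).mul ((h0.comp tendsto_two_mul_nhdsGT_zero).const_add 1)) (by norm_num)
  rw [add_zero, mul_one, div_one, ← sq] at h
  refine h.congr' ?_
  filter_upwards [self_mem_nhdsWithin] with w hw
  have hw0 : 0 < w := hw
  have hG := GFun_nonneg hα0.le hw0.le
  have hG2 := GFun_nonneg hα0.le (show 0 ≤ 2 * w by positivity)
  have i1 := hL.integrable_exp_restRatio t hw0.le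
  have i2 := hL.integrable_exp_restRatio t (show 0 ≤ 2 * w by positivity)
  have e : ∀ ω, ((1 - Real.exp (-w * restRatio L t ω)) / w) ^ 2 =
      (1 - 2 * Real.exp (-w * restRatio L t ω) + Real.exp (-(2 * w) * restRatio L t ω)) /
        w ^ 2 := by
    intro ω
    have : Real.exp (-(2 * w) * restRatio L t ω) = Real.exp (-w * restRatio L t ω) ^ 2 := by
      rw [← Real.exp_nat_mul]
      push_cast
      ring_nf
    rw [this]
    ring
  simp only [e]
  have i3 : Integrable (fun ω => 1 - 2 * Real.exp (-w * restRatio L t ω)) P :=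
    (integrable_const 1).sub (i1.const_mul 2)
  rw [integral_div, integral_add i3 i2, integral_sub (integrable_const 1)
    (i1.const_mul 2), integral_const_mul,
    hL.integral_exp_restRatio hα0 hα1 ht hw0.le,
    hL.integral_exp_restRatio hα0 hα1 ht (by positivity)]
  simp only [integral_const, probReal_univ, smul_eq_mul, mul_one, Pi.div_apply,
    Function.comp_apply]
  have hne1 : 1 + GFun α w ≠ 0 := by positivity
  have hne2 : 1 + GFun α (2 * w) ≠ 0 := by positivity
  field_simp
  ring

lemma IsSelfsimilarSubordinator.memLp_restRatio (hα0 : 0 < α) (hα1 : α < 1)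
    (hL : IsSelfsimilarSubordinator α L P) (ht : 0 < t) : MemLp (restRatio L t) 2 P :=
  (memLp_two_iff_integrable_sq (hL.aemeasurable_restRatio t).aestronglyMeasurable).2
    (hL.integral_restRatio_sq hα0 hα1 ht).1

lemma IsSelfsimilarSubordinator.variance_restRatio (hα0 : 0 < α) (hα1 : α < 1)
    (hL : IsSelfsimilarSubordinator α L P) (ht : 0 < t) :
    variance (restRatio L t) P = α / ((1 - α) ^ 2 * (2 - α)) := by
  have h1 : 1 - α ≠ 0 := by linarith
  have h2 : 2 - α ≠ 0 := by linarith
  rw [variance_eq_sub (hL.memLp_restRatio hα0 hα1 ht), hL.integral_restRatio hα0 hα1 ht]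
  simp only [Pi.pow_apply]
  rw [(hL.integral_restRatio_sq hα0 hα1 ht).2]
  field_simp
  ring

end restRatio

theorem mainTheorem3 {Ω : Type*} [MeasurableSpace Ω] (P : Measure Ω) [IsProbabilityMeasure P]
    (α : ℝ) (hα0 : 0 < α) (hα1 : α < 1) (L : ℝ≥0 → Ω → ℝ)
    (hL : IsSelfsimilarSubordinator α L P) :
    (∀ t : ℝ≥0, 0 < t →
      ∀ᵐ ω ∂P, IsGreatest (flightSizes L t ω) (greatestFlight L t ω)) ∧
    (∀ s t : ℝ≥0, 0 < s → 0 < t → IdentDistrib (restRatio L s) (restRatio L t) P P) ∧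
    (∀ t : ℝ≥0, 0 < t → ∀ w : ℝ, 0 ≤ w →
      ∫ ω, Real.exp (-w * restRatio L t ω) ∂P = 1 / (1 + GFun α w)) ∧
    (∀ t : ℝ≥0, 0 < t →
      MemLp (restRatio L t) 2 P ∧
      ∫ ω, restRatio L t ω ∂P = α / (1 - α) ∧
      variance (restRatio L t) P = α / ((1 - α) ^ 2 * (2 - α)) ∧
      variance (fun ω => restRatio L t ω / ∫ ω', restRatio L t ω' ∂P) P
        = 1 / (α * (2 - α))) := by
  refine ⟨fun t ht => ?_, fun s t hs ht => ?_,
    fun t ht w hw => hL.integral_exp_restRatio hα0 hα1 ht hw, fun t ht =>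
    ⟨hL.memLp_restRatio hα0 hα1 ht, hL.integral_restRatio hα0 hα1 ht,
      hL.variance_restRatio hα0 hα1 ht, ?_⟩⟩
  · filter_upwards [hL.ae_monotone, hL.cadlag, hL.ae_greatestFlight_pos hα0 hα1 ht]
      with ω hm hc hpos
    exact isGreatest_greatestFlight hm (fun s => (hc s).1) hpos
  · refine identDistrib_of_laplace_eq (hL.ae_restRatio_nonneg s) (hL.aemeasurable_restRatio s)
      (hL.ae_restRatio_nonneg t) (hL.aemeasurable_restRatio t) fun k => ?_
    rw [hL.integral_exp_restRatio hα0 hα1 hs k.cast_nonneg,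
      hL.integral_exp_restRatio hα0 hα1 ht k.cast_nonneg]
  · have h1 : 1 - α ≠ 0 := by linarith
    have h2 : 2 - α ≠ 0 := by linarith
    simp only [div_eq_inv_mul _ (∫ ω', restRatio L t ω' ∂P)]
    rw [variance_const_mul, hL.variance_restRatio hα0 hα1 ht, hL.integral_restRatio hα0 hα1 ht]
    field_simp
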